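/- Fix integers $K\ge 1$ and $p\ge 0$ and parameters not depending on $n$: a probability vector $\pi$ on $\{1,\dots,K\}$ with all $\pi_k>0$, a symmetric $K\times K$ matrix $\bar B\neq 0$ with nonnegative entries, and $\gamma^0\in\mathbb R^p$. Let $\rho_n>0$ with $\rho_n\to0$, and let $N_n=n(n-1)/2$. For each $n$, the pairwise covariates-adjusted stochastic block model (PCABM) consists of: labels $c_1,\dots,c_n$ that are i.i.d. with $\Pr(c_i=k)=\pi_k$; covariates $z_{ij}=z_{ji}\in\mathbb R^p$ with $z_{ii}=0$; and a symmetric matrix $A=(A_{ij})_{i,j\le n}$ with nonnegative integer entries and zero diagonal such that, conditionally on $c$ and $Z=(z_{ij})$, the entries $A_{ij}$, $i<j$, are independent with $$A_{ij}\sim\mathrm{Poisson}(\lambda_{ij}),\qquad \lambda_{ij}=\rho_n\bar B_{c_ic_j}e^{z_{ij}^T\gamma^0}.$$ Assume: 1. $\{z_{ij}:i<j\}$ are i.i.d. with a law that does not depend on $n$, and $\|z_{ij}\|_\infty\le\zeta$ almost surely for some constant $\zeta>0$. 2. With $\theta(\gamma)=\mathbb E\,e^{z_{12}^T\gamma}$,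 $\mu(\gamma)=\mathbb E\,z_{12}e^{z_{12}^T\gamma}$ and $\Sigma(\gamma)=\mathbb E\,z_{12}z_{12}^Te^{z_{12}^T\gamma}$, the matrix $\Sigma(\gamma^0)-\theta(\gamma^0)^{-1}\mu(\gamma^0)\mu(\gamma^0)^T$ is positive definite. 3. $e=e^{(n)}\in\{1,\dots,K\}^n$ is an initial assignment, deterministic or random (with no restriction on its dependence on $(c,Z,A)$), and there are constants $0<\kappa_1\le\kappa_2<1$ such that, for all sufficiently large $n$, almost surely $\kappa_1\le n_k(e)/n\le\kappa_2$ for every $k$, where $n_k(e)=\#\{i:e_i=k\}$. Let $$\ell_e(\gamma)=\sum_{i<j}A_{ij}z_{ij}^T\gamma-\frac12\sum_{k,l}O_{kl}(e)\log E_{kl}(e,\gamma),$$ where $$O_{kl}(e)=\sum_{i,j}A_{ij}\mathbf 1(e_i=k,e_j=l),\qquad E_{kl}(e,\gamma)=\sum_{i\ne j}e^{z_{ij}^T\gamma}\mathbf 1(e_i=k,e_j=l),$$ with $0\log0=0$. Let $\hat\gamma(e)$ be any maximizer of $\ell_e$ over $\mathbb R^p$ when a maximizer exists, and arbitrary otherwise.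 If $N_n\rho_n\to\infty$ as $n\to\infty$, then a maximizer of $\ell_e$ over $\mathbb R^p$ exists with probability tending to one, and $\hat\gamma(e)\to\gamma^0$ in probability. -/

import Mathlib

open MeasureTheory ProbabilityTheory Filter Topology Matrix

noncomputable section

namespace PCABM

/-- The unordered pairs of distinct nodes among `n` nodes, as ordered pairs `i < j`. -/
abbrev Pair (n : ℕ) : Type := {q : Fin n × Fin n // q.1 < q.2}

/-- Number of possible edges `N_n = n (n - 1) / 2`. -/
def numPairs (n : ℕ) : ℝ := (n : ℝ) * ((n : ℝ) - 1) / 2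

/-- Poisson rate of the edge `ij`: `λ_ij = B_{c_i c_j} exp(z_ijᵀ γ₀)`. -/
def rate {n K p : ℕ} (B : Matrix (Fin K) (Fin K) ℝ) (γ₀ : Fin p → ℝ)
    (c : Fin n → Fin K) (Z : Fin n → Fin n → Fin p → ℝ) (i j : Fin n) : ℝ :=
  B (c i) (c j) * Real.exp (Z i j ⬝ᵥ γ₀)

/-- The pairwise covariates-adjusted stochastic block model on `n` nodes with `K` communities:
the labels `c` are i.i.d. with `Pr(c_i = k) = π k`; the covariates `Z` and the weighted adjacency
matrix `A` are symmetric with zero diagonal; and, conditionally on `(c, Z)`, the entries `A_ij`,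
`i < j`, are independent with `A_ij ∼ Poisson(λ_ij)` (that is, the joint conditional probability
mass function of `(A_ij)_{i < j}` is the product of these Poisson mass functions). -/
structure IsPCABM {Ω : Type*} [MeasurableSpace Ω] (P : Measure Ω) {n K p : ℕ}
    (π : Fin K → ℝ) (B : Matrix (Fin K) (Fin K) ℝ) (γ₀ : Fin p → ℝ)
    (c : Ω → Fin n → Fin K) (Z : Ω → Fin n → Fin n → Fin p → ℝ)
    (A : Ω → Fin n → Fin n → ℕ) : Prop where
  measurable_c : Measurable c
  measurable_Z : Measurable Z
  measurable_A : Measurable A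
  indep_c : iIndepFun (fun (i : Fin n) (ω : Ω) => c ω i) P
  law_c : ∀ (i : Fin n) (k : Fin K), P.real {ω | c ω i = k} = π k
  Z_symm : ∀ ω i j, Z ω i j = Z ω j i
  Z_diag : ∀ ω i, Z ω i i = 0
  A_symm : ∀ ω i j, A ω i j = A ω j i
  A_diag : ∀ ω i, A ω i i = 0
  condLaw_A : ∀ a : Pair n → ℕ,
    P⟦{ω | ∀ q : Pair n, A ω q.1.1 q.1.2 = a q} |
        MeasurableSpace.comap (fun ω => (c ω, Z ω)) inferInstance⟧
      =ᵐ[P] fun ω => ∏ q : Pair n,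
        (poissonMeasure (rate B γ₀ (c ω) (Z ω) q.1.1 q.1.2).toNNReal).real {a q}

/-- The covariates `z_ij`, `i < j`, are i.i.d. with common law `ν` and bounded by `ζ` in sup norm
(the norm of `Fin p → ℝ`). -/
structure BoundedIID {Ω : Type*} [MeasurableSpace Ω] (P : Measure Ω) {n p : ℕ}
    (ν : Measure (Fin p → ℝ)) (ζ : ℝ) (Z : Ω → Fin n → Fin n → Fin p → ℝ) : Prop where
  indep : iIndepFun (fun (q : Pair n) (ω : Ω) => Z ω q.1.1 q.1.2) P
  law : ∀ q : Pair n, P.map (fun ω => Z ω q.1.1 q.1.2) = ν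
  bounded : ∀ q : Pair n, ∀ᵐ ω ∂P, ‖Z ω q.1.1 q.1.2‖ ≤ ζ

/-- `θ(γ) = E[exp(zᵀγ)]`, `z ∼ ν`. -/
def theta {p : ℕ} (ν : Measure (Fin p → ℝ)) (γ : Fin p → ℝ) : ℝ :=
  ∫ z, Real.exp (z ⬝ᵥ γ) ∂ν

/-- `μ(γ) = E[z exp(zᵀγ)]`, `z ∼ ν`. -/
def muVec {p : ℕ} (ν : Measure (Fin p → ℝ)) (γ : Fin p → ℝ) : Fin p → ℝ :=
  fun r => ∫ z, z r * Real.exp (z ⬝ᵥ γ) ∂ν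

/-- `Σ(γ) = E[z zᵀ exp(zᵀγ)]`, `z ∼ ν`. -/
def sigmaMat {p : ℕ} (ν : Measure (Fin p → ℝ)) (γ : Fin p → ℝ) : Matrix (Fin p) (Fin p) ℝ :=
  Matrix.of fun r s => ∫ z, z r * z s * Real.exp (z ⬝ᵥ γ) ∂ν

/-- Community size `n_k(e)`. -/
def commSize {n K : ℕ} (e : Fin n → Fin K) (k : Fin K) : ℕ :=
  (Finset.univ.filter fun i => e i = k).card

/-- `O_kl(e) = ∑_{i, j} A_ij 1(e_i = k, e_j = l)`. -/
def blockEdges {n K : ℕ} (A : Fin n → Fin n → ℕ) (e : Fin n → Fin K) (k l : Fin K) : ℝ :=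
  ∑ i, ∑ j, if e i = k ∧ e j = l then (A i j : ℝ) else 0

/-- `E_kl(e, γ) = ∑_{i ≠ j} exp(z_ijᵀ γ) 1(e_i = k, e_j = l)`. -/
def blockExp {n K p : ℕ} (Z : Fin n → Fin n → Fin p → ℝ) (e : Fin n → Fin K) (γ : Fin p → ℝ)
    (k l : Fin K) : ℝ :=
  ∑ i, ∑ j, if i ≠ j ∧ e i = k ∧ e j = l then Real.exp (Z i j ⬝ᵥ γ) else 0

/-- Profile log-likelihood
`ℓ_e(γ) = ∑_{i<j} A_ij z_ijᵀ γ - (1/2) ∑_{k,l} O_kl(e) log E_kl(e, γ)`.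
An empty block has `O_kl = E_kl = 0` and contributes `0`. -/
def profileLogLik {n K p : ℕ} (A : Fin n → Fin n → ℕ) (Z : Fin n → Fin n → Fin p → ℝ)
    (e : Fin n → Fin K) (γ : Fin p → ℝ) : ℝ :=
  (∑ q : Pair n, (A q.1.1 q.1.2 : ℝ) * (Z q.1.1 q.1.2 ⬝ᵥ γ))
    - (1 / 2) * ∑ k, ∑ l, blockEdges A e k l * Real.log (blockExp Z e γ k l)

/-- `γ` is a global maximizer of the profile log-likelihood `ℓ_e` over `ℝ^p`. -/
def IsProfileMLE {n K p : ℕ} (A : Fin n → Fin n → ℕ) (Z : Fin n → Fin n → Fin p → ℝ)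
    (e : Fin n → Fin K) (γ : Fin p → ℝ) : Prop :=
  ∀ γ' : Fin p → ℝ, profileLogLik A Z e γ' ≤ profileLogLik A Z e γ

end PCABM

end

open scoped NNReal ENNReal Nat

/-! ### Moments of weighted sums of independent Poisson variables. -/

namespace PCABM

/-! The profile log-likelihood is always concave: a linear term minus nonnegative multiples of
log-sum-exp functions. So it suffices that with high probability `ℓ_e(γ) < ℓ_e(γ₀)` on the sphere of
radius `ε` about `γ₀`: then a maximizer exists and all maximizers lie inside
(`exists_forall_le_of_lt_on_sphere`). By compactness a small ball around each `γ` on the sphere is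
enough (`exists_whp_profileLogLik_lt`).

For fixed `γ`, Hoeffding with a union bound over all `K ^ n` assignments gives `log E_kl(e, γ) ≈ log
(block count) + log θ(γ)` uniformly in `e` (`whp_abs_log_blockExp_sub_le`), so `e` may depend on the
data arbitrarily. In `ℓ_e(γ) - ℓ_e(γ₀)` the counts cancel and `e` disappears, leaving `∑ A_ij
tilt(z_ij)` up to a small multiple of `∑ A_ij`, which is `O(N_n ρ_n)`.

By Chebyshev this sum is within `o(N_n ρ_n)` of its conditional mean: the variance is only `O(N_n
ρ_n)`, and `N_n ρ_n → ∞`. By the uniform Hoeffding bound at the true labels, the conditional mean is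
close to `ρ_n m ∑ B̄_{c_i c_j}` with `m = E[exp(zᵀγ₀) tilt(z)]`. Here `m < 0` by `exp t ≥ 1 + t` and
positive definiteness (`integral_exp_mul_tilt_neg`), while `∑ B̄_{c_i c_j}` is of order `n²`. All
failure probabilities are outer measures, so `e` and `γhat` need not be measurable. -/

lemma hasSum_poisson_mul_cast (r : ℝ≥0) :
    HasSum (fun n : ℕ => Real.exp (-r) * (r : ℝ) ^ n / n ! * (n : ℝ)) r := by
  -- The term at `0` vanishes; after the shift, `n + 1` cancels against `(n + 1)!`.
  rw [← hasSum_nat_add_iff' 1]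
  have h := (hasSum_one_poissonMeasure r).mul_left (r : ℝ)
  simp only [mul_one] at h
  convert! h using 1
  · funext n
    rw [Nat.factorial_succ]
    push_cast
    field_simp
    ring
  · simp

lemma hasSum_poisson_mul_sq (r : ℝ≥0) :
    HasSum (fun n : ℕ => Real.exp (-r) * (r : ℝ) ^ n / n ! * (n : ℝ) ^ 2) (r ^ 2 + r : ℝ) := by
  rw [← hasSum_nat_add_iff' 1]
  have h := ((hasSum_poisson_mul_cast r).add (hasSum_one_poissonMeasure r)).mul_left (r : ℝ)
  convert! h using 1
  · funext n
    rw [Nat.factorial_succ]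
    push_cast
    field_simp
    ring
  · simp; ring

lemma integral_cast_poissonMeasure (r : ℝ≥0) : ∫ n : ℕ, (n : ℝ) ∂poissonMeasure r = r := by
  rw [integral_poissonMeasure]
  simpa using (hasSum_poisson_mul_cast r).tsum_eq

lemma memLp_two_cast_poissonMeasure (r : ℝ≥0) :
    MemLp (fun n : ℕ => (n : ℝ)) 2 (poissonMeasure r) := by
  rw [memLp_two_iff_integrable_sq .of_discrete, integrable_poissonMeasure_iff]
  simpa using (hasSum_poisson_mul_sq r).summable

lemma variance_cast_poissonMeasure (r : ℝ≥0) :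
    variance (fun n : ℕ => (n : ℝ)) (poissonMeasure r) = r := by
  rw [variance_eq_sub (memLp_two_cast_poissonMeasure r), integral_cast_poissonMeasure]
  have : ∫ n : ℕ, ((fun n : ℕ => (n : ℝ)) ^ 2) n ∂poissonMeasure r = r ^ 2 + r := by
    rw [integral_poissonMeasure]
    simpa using (hasSum_poisson_mul_sq r).tsum_eq
  rw [this]; ring

/-- The second moment of a centered weighted sum of independent Poisson variables. -/
lemma lintegral_sq_sum_pi_poissonMeasure {ι : Type*} [Fintype ι] (r : ι → ℝ≥0) (w : ι → ℝ) :
    ∫⁻ a : ι → ℕ, ENNReal.ofReal ((∑ q, w q * ((a q : ℝ) - r q)) ^ 2)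
        ∂Measure.pi (fun q => poissonMeasure (r q))
      = ENNReal.ofReal (∑ q, w q ^ 2 * r q) := by
  have hmem : ∀ q, MemLp (fun n : ℕ => w q * (n : ℝ)) 2 (poissonMeasure (r q)) :=
    fun q => (memLp_two_cast_poissonMeasure (r q)).const_mul (w q)
  have hmem' : ∀ q, MemLp (fun a : ι → ℕ => w q * (a q : ℝ)) 2
      (Measure.pi (fun q => poissonMeasure (r q))) := fun q =>
    (hmem q).comp_measurePreserving
      (measurePreserving_eval (fun q => poissonMeasure (r q)) q)
  have hsum : MemLp (fun a : ι → ℕ => ∑ q, w q * (a q : ℝ)) 2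
      (Measure.pi (fun q => poissonMeasure (r q))) := memLp_finsetSum _ fun q _ => hmem' q
  have hint : ∀ q, ∫ a : ι → ℕ, w q * (a q : ℝ) ∂Measure.pi (fun q => poissonMeasure (r q))
      = w q * r q := by
    intro q
    have := (measurePreserving_eval (fun q => poissonMeasure (r q)) q).hasLaw.integral_comp
      (f := fun n : ℕ => w q * (n : ℝ)) .of_discrete
    simp only [Function.comp_def, Function.eval] at this
    rw [this, integral_const_mul, integral_cast_poissonMeasure]
  have hmean : ∫ a : ι → ℕ, ∑ q, w q * (a q : ℝ) ∂Measure.pi (fun q => poissonMeasure (r q))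
      = ∑ q, w q * r q := by
    rw [integral_finsetSum _ fun q _ => (hmem' q).integrable (by norm_num)]
    exact Finset.sum_congr rfl fun q _ => hint q
  have hvar := variance_sum_pi hmem
  have h2 : ∀ q, variance (fun n : ℕ => w q * (n : ℝ)) (poissonMeasure (r q))
      = w q ^ 2 * r q := by
    intro q
    rw [variance_const_mul, variance_cast_poissonMeasure]
  have hfun : (∑ q, fun a : ι → ℕ => w q * (a q : ℝ)) = fun a : ι → ℕ => ∑ q, w q * (a q : ℝ) := by
    ext a; simp
  simp only [h2] at hvar
  rw [hfun] at hvar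
  rw [← hvar, hsum.ofReal_variance_eq, evariance_eq_lintegral_ofReal, hmean]
  refine lintegral_congr fun a => ?_
  simp only [mul_sub, Finset.sum_sub_distrib]

end PCABM

/-! ### Conditional second moments of the adjacency matrix and Chebyshev's inequality. -/

namespace PCABM

variable {Ω : Type*} [MeasurableSpace Ω] {P : Measure Ω} {n K p : ℕ}
  {π : Fin K → ℝ} {B : Matrix (Fin K) (Fin K) ℝ} {γ₀ : Fin p → ℝ}
  {c : Ω → Fin n → Fin K} {Z : Ω → Fin n → Fin n → Fin p → ℝ} {A : Ω → Fin n → Fin n → ℕ}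

lemma rate_nonneg (hB : ∀ a b, 0 ≤ B a b) (c : Fin n → Fin K) (Z : Fin n → Fin n → Fin p → ℝ)
    (i j : Fin n) : 0 ≤ rate B γ₀ c Z i j := mul_nonneg (hB _ _) (Real.exp_nonneg _)

lemma measurable_dotProduct_right (γ : Fin p → ℝ) :
    Measurable fun z : Fin p → ℝ => z ⬝ᵥ γ := by
  unfold dotProduct
  fun_prop

lemma measurable_rate (i j : Fin n) :
    Measurable fun x : (Fin n → Fin K) × (Fin n → Fin n → Fin p → ℝ) =>
      rate B γ₀ x.1 x.2 i j := by
  unfold rate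
  refine Measurable.mul ?_ ?_
  · exact (measurable_of_countable fun y : Fin n → Fin K => B (y i) (y j)).comp measurable_fst
  · refine Real.measurable_exp.comp ((measurable_dotProduct_right γ₀).comp ?_)
    fun_prop

/-- Conditional on `(c, Z)`, expectations over an event `A = a` integrate the Poisson weights. -/
lemma IsPCABM.setLIntegral_eq [IsFiniteMeasure P] (h : IsPCABM P π B γ₀ c Z A) (a : Pair n → ℕ)
    {g : (Fin n → Fin K) × (Fin n → Fin n → Fin p → ℝ) → ℝ≥0∞} (hg : Measurable g) :
    ∫⁻ ω in {ω | ∀ q : Pair n, A ω q.1.1 q.1.2 = a q}, g (c ω, Z ω) ∂P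
      = ∫⁻ ω, ENNReal.ofReal (∏ q : Pair n,
          (poissonMeasure (rate B γ₀ (c ω) (Z ω) q.1.1 q.1.2).toNNReal).real {a q})
          * g (c ω, Z ω) ∂P := by
  have hX : Measurable fun ω => (c ω, Z ω) := h.measurable_c.prodMk h.measurable_Z
  set S : Set Ω := {ω | ∀ q : Pair n, A ω q.1.1 q.1.2 = a q} with hS_def
  have hS : MeasurableSet S := by
    have : S = ⋂ q : Pair n, (fun ω => A ω q.1.1 q.1.2) ⁻¹' {a q} := by
      ext ω; simp [hS_def]
    rw [this]
    refine MeasurableSet.iInter fun q => ?_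
    have hm : Measurable fun ω => A ω q.1.1 q.1.2 :=
      (measurable_pi_apply q.1.2).comp ((measurable_pi_apply q.1.1).comp h.measurable_A)
    exact hm (measurableSet_singleton _)
  have hwX : Measurable fun x : (Fin n → Fin K) × (Fin n → Fin n → Fin p → ℝ) =>
      ∏ q : Pair n, (poissonMeasure (rate B γ₀ x.1 x.2 q.1.1 q.1.2).toNNReal).real {a q} := by
    refine Finset.measurable_prod _ fun q _ => ?_
    have hr := measurable_rate (B := B) (γ₀ := γ₀) (n := n) (K := K) (p := p) q.1.1 q.1.2
    simp only [poissonMeasure_real_singleton]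
    fun_prop
  have hw := hwX.comp hX
  set w : Ω → ℝ := fun ω => ∏ q : Pair n,
    (poissonMeasure (rate B γ₀ (c ω) (Z ω) q.1.1 q.1.2).toNNReal).real {a q} with hw_def
  have hw0 : ∀ ω, 0 ≤ w ω := fun ω => Finset.prod_nonneg fun q _ => measureReal_nonneg
  have hw1 : ∀ ω, w ω ≤ 1 := fun ω =>
    Finset.prod_le_one (fun q _ => measureReal_nonneg) fun q _ => measureReal_le_one
  have hwm : Measurable w := hw
  have hwi : Integrable w P := Integrable.of_bound hwm.aestronglyMeasurable 1
    (ae_of_all _ fun ω => by rw [Real.norm_of_nonneg (hw0 ω)]; exact hw1 ω)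
  -- The conditional law, tested on events generated by `(c, Z)`, is an identity of two measures on
  -- the space of pairs; every measurable `g` can then be integrated.
  have hmap : (P.restrict S).map (fun ω => (c ω, Z ω))
      = (P.withDensity fun ω => ENNReal.ofReal (w ω)).map (fun ω => (c ω, Z ω)) := by
    ext t ht
    rw [Measure.map_apply hX ht, Measure.map_apply hX ht, Measure.restrict_apply (hX ht),
      withDensity_apply _ (hX ht),
      ← ofReal_integral_eq_lintegral_ofReal hwi.integrableOn (ae_of_all _ hw0)]
    have hle : MeasurableSpace.comap (fun ω => (c ω, Z ω)) inferInstance ≤ ‹MeasurableSpace Ω› :=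
      hX.comap_le
    have h1 := setIntegral_condExp hle
      (f := S.indicator fun _ => (1 : ℝ)) (μ := P) ((integrable_const _).indicator hS)
      (s := (fun ω => (c ω, Z ω)) ⁻¹' t) ⟨t, ht, rfl⟩
    rw [setIntegral_congr_ae (g := w) (hX ht)
      ((h.condLaw_A a).mono fun ω hω _ => hω), integral_indicator hS] at h1
    rw [h1, Measure.restrict_restrict hS]
    simp [Set.inter_comm]
  rw [← lintegral_map hg hX, hmap, lintegral_map hg hX,
    lintegral_withDensity_eq_lintegral_mul _ (by fun_prop)
      (show Measurable fun ω => g (c ω, Z ω) from hg.comp hX)]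
  rfl

/-- The second moment of a weighted sum of the entries of `A`, centered by the rates. -/
lemma IsPCABM.lintegral_sq_sum [IsFiniteMeasure P] (h : IsPCABM P π B γ₀ c Z A)
    (hB : ∀ a b, 0 ≤ B a b) {g : (Fin p → ℝ) → ℝ} (hg : Measurable g) :
    ∫⁻ ω, ENNReal.ofReal ((∑ q : Pair n, g (Z ω q.1.1 q.1.2) *
        ((A ω q.1.1 q.1.2 : ℝ) - rate B γ₀ (c ω) (Z ω) q.1.1 q.1.2)) ^ 2) ∂P
      = ∫⁻ ω, ENNReal.ofReal (∑ q : Pair n, g (Z ω q.1.1 q.1.2) ^ 2 *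
          rate B γ₀ (c ω) (Z ω) q.1.1 q.1.2) ∂P := by
  have hX : Measurable fun ω => (c ω, Z ω) := h.measurable_c.prodMk h.measurable_Z
  let S : (Pair n → ℕ) → Set Ω := fun a => {ω | ∀ q : Pair n, A ω q.1.1 q.1.2 = a q}
  have hAq : Measurable fun ω => fun q : Pair n => A ω q.1.1 q.1.2 :=
    measurable_pi_lambda _ fun q =>
      (measurable_pi_apply q.1.2).comp ((measurable_pi_apply q.1.1).comp h.measurable_A)
  have hS_eq : ∀ a, S a = (fun ω => fun q : Pair n => A ω q.1.1 q.1.2) ⁻¹' {a} := by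
    intro a; ext ω; simp [S, funext_iff]
  have hS : ∀ a, MeasurableSet (S a) := fun a => by
    rw [hS_eq]; exact hAq (measurableSet_singleton a)
  have hdisj : Pairwise (Function.onFun Disjoint S) := by
    intro a b hab
    simp only [Function.onFun, hS_eq]
    exact Disjoint.preimage _ (by simpa using hab)
  have hcover : (⋃ a, S a) = Set.univ := by
    ext ω; simp [S]
    exact ⟨fun q => A ω q.1.1 q.1.2, fun _ _ _ => rfl⟩
  let G : (Pair n → ℕ) → (Fin n → Fin K) × (Fin n → Fin n → Fin p → ℝ) → ℝ≥0∞ := fun a x =>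
    ENNReal.ofReal ((∑ q : Pair n, g (x.2 q.1.1 q.1.2) *
        ((a q : ℝ) - rate B γ₀ x.1 x.2 q.1.1 q.1.2)) ^ 2)
  have hG : ∀ a, Measurable (G a) := by
    intro a
    refine ENNReal.measurable_ofReal.comp (Measurable.pow_const ?_ 2)
    refine Finset.measurable_sum _ fun q _ => Measurable.mul (hg.comp ?_)
      (measurable_const.sub (measurable_rate q.1.1 q.1.2))
    fun_prop
  have hw : ∀ a : Pair n → ℕ, Measurable fun ω => ENNReal.ofReal (∏ q : Pair n,
      (poissonMeasure (rate B γ₀ (c ω) (Z ω) q.1.1 q.1.2).toNNReal).real {a q}) := by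
    intro a
    refine ENNReal.measurable_ofReal.comp (Finset.measurable_prod _ fun q _ => ?_)
    have hr := (measurable_rate (B := B) (γ₀ := γ₀) (n := n) (K := K) (p := p) q.1.1 q.1.2).comp hX
    simp only [Function.comp_def] at hr
    simp only [poissonMeasure_real_singleton]
    fun_prop
  -- Split over the countably many values of `A`. On each piece the integrand depends on `(c, Z)`
  -- only; exchanging sum and integral then reassembles, for each fixed `ω`, a product-Poisson
  -- second moment.
  rw [← setLIntegral_univ, ← hcover, lintegral_iUnion hS hdisj]
  have hstep : ∀ a, ∫⁻ ω in S a, ENNReal.ofReal ((∑ q : Pair n, g (Z ω q.1.1 q.1.2) *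
        ((A ω q.1.1 q.1.2 : ℝ) - rate B γ₀ (c ω) (Z ω) q.1.1 q.1.2)) ^ 2) ∂P
      = ∫⁻ ω, ENNReal.ofReal (∏ q : Pair n,
          (poissonMeasure (rate B γ₀ (c ω) (Z ω) q.1.1 q.1.2).toNNReal).real {a q})
          * G a (c ω, Z ω) ∂P := by
    intro a
    rw [← h.setLIntegral_eq a (hG a)]
    refine setLIntegral_congr_fun (hS a) fun ω hω => ?_
    have hω' : ∀ q : Pair n, A ω q.1.1 q.1.2 = a q := hω
    simp only [G, hω']
  have hGX : ∀ a, Measurable fun ω => G a (c ω, Z ω) := fun a => (hG a).comp hX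
  rw [tsum_congr hstep, ← lintegral_tsum fun a => Measurable.aemeasurable (by fun_prop)]
  refine lintegral_congr fun ω => ?_
  have hpi := lintegral_sq_sum_pi_poissonMeasure
    (fun q : Pair n => (rate B γ₀ (c ω) (Z ω) q.1.1 q.1.2).toNNReal)
    (fun q : Pair n => g (Z ω q.1.1 q.1.2))
  simp only [Real.coe_toNNReal _ (rate_nonneg hB _ _ _ _)] at hpi
  rw [← hpi, lintegral_countable']
  refine tsum_congr fun a => ?_
  rw [mul_comm]
  congr 1
  rw [Measure.pi_singleton, ENNReal.ofReal_prod_of_nonneg fun q _ => measureReal_nonneg]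
  exact Finset.prod_congr rfl fun q _ => ofReal_measureReal

lemma abs_dotProduct_le {ζ : ℝ} {z : Fin p → ℝ} (hz : ‖z‖ ≤ ζ) (γ : Fin p → ℝ) :
    |z ⬝ᵥ γ| ≤ p * ζ * ‖γ‖ := by
  unfold dotProduct
  refine (Finset.abs_sum_le_sum_abs _ _).trans ?_
  calc ∑ i, |z i * γ i| ≤ ∑ _i : Fin p, ζ * ‖γ‖ := by
        refine Finset.sum_le_sum fun i _ => ?_
        rw [abs_mul]
        have h1 : |z i| ≤ ζ := (norm_le_pi_norm z i).trans hz
        exact mul_le_mul h1 (norm_le_pi_norm γ i) (abs_nonneg _) ((abs_nonneg _).trans h1)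
    _ = p * ζ * ‖γ‖ := by simp; ring

/-- A sum over ordered pairs with vanishing diagonal, as a sum over unordered pairs. -/
lemma sum_sum_eq_sum_pair (F : Fin n → Fin n → ℝ) (hF : ∀ i, F i i = 0) :
    ∑ i, ∑ j, F i j = ∑ q : Pair n, (F q.1.1 q.1.2 + F q.1.2 q.1.1) := by
  rw [Finset.sum_add_distrib, ← Fintype.sum_prod_type']
  have h1 : ∑ q : Pair n, F q.1.1 q.1.2
      = ∑ x : Fin n × Fin n, if x.1 < x.2 then F x.1 x.2 else 0 := by
    rw [← Finset.sum_filter]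
    exact (Finset.sum_subtype _ (by simp) (fun x : Fin n × Fin n => F x.1 x.2)).symm
  have h2 : ∑ q : Pair n, F q.1.2 q.1.1
      = ∑ x : Fin n × Fin n, if x.2 < x.1 then F x.1 x.2 else 0 := by
    have h3 : ∑ q : Pair n, F q.1.2 q.1.1
        = ∑ x : Fin n × Fin n, if x.1 < x.2 then F x.2 x.1 else 0 := by
      rw [← Finset.sum_filter]
      exact (Finset.sum_subtype _ (by simp) (fun x : Fin n × Fin n => F x.2 x.1)).symm
    exact h3.trans (Equiv.sum_comp (Equiv.prodComm (Fin n) (Fin n))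
      fun x : Fin n × Fin n => if x.2 < x.1 then F x.1 x.2 else 0)
  rw [h1, h2, ← Finset.sum_add_distrib]
  refine Finset.sum_congr rfl fun x _ => ?_
  rcases lt_trichotomy x.1 x.2 with h | h | h
  · simp [h, h.le.not_gt]
  · simp [h, hF]
  · simp [h, h.le.not_gt]

lemma card_pair (n : ℕ) : (Fintype.card (Pair n) : ℝ) = numPairs n := by
  have h := sum_sum_eq_sum_pair (n := n) (fun i j => if i = j then 0 else 1) (by simp)
  have h1 : ∀ q : Pair n, q.1.1 ≠ q.1.2 := fun q => q.2.ne
  have h2 : ∀ i : Fin n, ∑ j, (if i = j then (0 : ℝ) else 1) = n - 1 := by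
    intro i
    have : ∀ j : Fin n, (if i = j then (0 : ℝ) else 1) = 1 - if i = j then 1 else 0 := by
      intro j; split_ifs <;> simp
    simp [this]
  simp only [h2, h1, (h1 _).symm, if_false] at h
  simp at h
  rw [numPairs]
  linarith

lemma rate_smul (r : ℝ) (c : Fin n → Fin K) (Z : Fin n → Fin n → Fin p → ℝ) (i j : Fin n) :
    rate (r • B) γ₀ c Z i j = r * rate B γ₀ c Z i j := by
  simp [rate, mul_assoc]

lemma BoundedIID.ae_norm_le {ν : Measure (Fin p → ℝ)} {ζ : ℝ} (h : BoundedIID P ν ζ Z) :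
    ∀ᵐ ω ∂P, ∀ q : Pair n, ‖Z ω q.1.1 q.1.2‖ ≤ ζ := ae_all_iff.2 h.bounded

/-- Chebyshev's inequality for weighted sums of the entries of `A` centered by the rates. -/
lemma IsPCABM.measure_le_abs_sum [IsProbabilityMeasure P] (h : IsPCABM P π B γ₀ c Z A)
    (hB : ∀ a b, 0 ≤ B a b) {ν : Measure (Fin p → ℝ)} {ζ : ℝ} (hZ : BoundedIID P ν ζ Z)
    {g : (Fin p → ℝ) → ℝ} (hg : Measurable g) {C : ℝ} (hgC : ∀ z, ‖z‖ ≤ ζ → |g z| ≤ C)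
    {b : ℝ} (hb : ∀ k l, B k l ≤ b) {t : ℝ} (ht : 0 < t) :
    P {ω | t ≤ |∑ q : Pair n, g (Z ω q.1.1 q.1.2) *
        ((A ω q.1.1 q.1.2 : ℝ) - rate B γ₀ (c ω) (Z ω) q.1.1 q.1.2)|}
      ≤ ENNReal.ofReal (numPairs n * (C ^ 2 * (b * Real.exp (p * ζ * ‖γ₀‖))) / t ^ 2) := by
  have hX : Measurable fun ω => (c ω, Z ω) := h.measurable_c.prodMk h.measurable_Z
  set F : Ω → ℝ := fun ω => ∑ q : Pair n, g (Z ω q.1.1 q.1.2) *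
        ((A ω q.1.1 q.1.2 : ℝ) - rate B γ₀ (c ω) (Z ω) q.1.1 q.1.2) with hF
  have hFm : Measurable F := by
    refine Finset.measurable_sum _ fun q _ => ?_
    have hr : Measurable fun ω => rate B γ₀ (c ω) (Z ω) q.1.1 q.1.2 :=
      (measurable_rate q.1.1 q.1.2).comp hX
    have hz : Measurable fun ω => Z ω q.1.1 q.1.2 :=
      (measurable_pi_apply q.1.2).comp ((measurable_pi_apply q.1.1).comp h.measurable_Z)
    have ha : Measurable fun ω => (A ω q.1.1 q.1.2 : ℝ) :=
      (measurable_of_countable fun n : ℕ => (n : ℝ)).comp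
        ((measurable_pi_apply q.1.2).comp ((measurable_pi_apply q.1.1).comp h.measurable_A))
    exact (hg.comp hz).mul (ha.sub hr)
  have hset : {ω | t ≤ |F ω|} = {ω | ENNReal.ofReal (t ^ 2) ≤ ENNReal.ofReal (F ω ^ 2)} := by
    ext ω
    simp only [Set.mem_ofPred_eq]
    rw [ENNReal.ofReal_le_ofReal_iff (sq_nonneg _), sq_le_sq, abs_of_pos ht]
  rw [hset]
  refine (meas_ge_le_lintegral_div (by fun_prop) (by simpa using ht.ne')
    ENNReal.ofReal_ne_top).trans ?_
  rw [h.lintegral_sq_sum hB hg, ENNReal.ofReal_div_of_pos (by positivity)]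
  gcongr
  calc _ ≤ ∫⁻ _ω, ENNReal.ofReal
        (numPairs n * (C ^ 2 * (b * Real.exp (p * ζ * ‖γ₀‖)))) ∂P := by
        refine lintegral_mono_ae ?_
        filter_upwards [hZ.ae_norm_le] with ω hω
        refine ENNReal.ofReal_le_ofReal ?_
        refine (Finset.sum_le_card_nsmul _ _ (C ^ 2 * (b * Real.exp (p * ζ * ‖γ₀‖))) ?_).trans ?_
        · intro q _
          have h1 := hgC _ (hω q)
          have h2 := (le_abs_self _).trans (abs_dotProduct_le (hω q) γ₀)
          have h3 : g (Z ω q.1.1 q.1.2) ^ 2 ≤ C ^ 2 := sq_le_sq.2 (h1.trans (le_abs_self C))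
          refine mul_le_mul h3 ?_ (rate_nonneg hB _ _ _ _) (sq_nonneg _)
          exact mul_le_mul (hb _ _) (Real.exp_le_exp.2 h2) (Real.exp_nonneg _)
            ((hB _ _).trans (hb (c ω q.1.1) (c ω q.1.2)))
        · rw [nsmul_eq_mul, Finset.card_univ, card_pair]
    _ = _ := by simp

end PCABM

/-! ### High-probability events and concentration. -/

namespace PCABM

variable {Ω : Type*} [MeasurableSpace Ω] {P : Measure Ω} {K p : ℕ}

/-- The (outer) probability that `S n` fails tends to zero. -/
def Whp (P : Measure Ω) (S : ℕ → Ω → Prop) : Prop :=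
  Tendsto (fun n => P {ω | ¬ S n ω}) atTop (𝓝 0)

lemma Whp.mono {S T : ℕ → Ω → Prop} (hS : Whp P S) (h : ∀ᶠ n in atTop, ∀ ω, S n ω → T n ω) :
    Whp P T := by
  refine tendsto_of_tendsto_of_tendsto_of_le_of_le' tendsto_const_nhds hS
    (Eventually.of_forall fun _ => zero_le) ?_
  filter_upwards [h] with n hn
  exact measure_mono fun ω hω hS => hω (hn ω hS)

lemma Whp.and {S T : ℕ → Ω → Prop} (hS : Whp P S) (hT : Whp P T) :
    Whp P fun n ω => S n ω ∧ T n ω := by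
  have h := hS.add hT
  rw [add_zero] at h
  refine tendsto_of_tendsto_of_tendsto_of_le_of_le tendsto_const_nhds h
    (fun _ => zero_le) fun n => ?_
  refine (measure_mono fun ω hω => ?_).trans (measure_union_le _ _)
  by_cases h : S n ω
  · exact Or.inr fun hT => hω ⟨h, hT⟩
  · exact Or.inl h

lemma Whp.forall_finset {ι : Type*} (s : Finset ι) {S : ι → ℕ → Ω → Prop}
    (h : ∀ i ∈ s, Whp P (S i)) : Whp P fun n ω => ∀ i ∈ s, S i n ω := by
  classical
  induction s using Finset.induction_on with
  | empty => simp [Whp]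
  | insert a s _ ih =>
    refine ((h a (by simp)).and (ih fun i hi => h i (by simp [hi]))).mono ?_
    refine Eventually.of_forall fun n ω hω i hi => ?_
    rcases Finset.mem_insert.1 hi with rfl | hi
    · exact hω.1
    · exact hω.2 i hi

lemma Whp.of_ae {S : ℕ → Ω → Prop} (h : ∀ᶠ n in atTop, ∀ᵐ ω ∂P, S n ω) : Whp P S :=
  tendsto_const_nhds.congr' (h.mono fun _ hn => (ae_iff.1 hn).symm)

lemma Whp.of_le {S : ℕ → Ω → Prop} {u : ℕ → ℝ} (hu : Tendsto u atTop (𝓝 0))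
    (h : ∀ᶠ n in atTop, P {ω | ¬ S n ω} ≤ ENNReal.ofReal (u n)) : Whp P S := by
  have h0 := ENNReal.tendsto_ofReal hu
  rw [ENNReal.ofReal_zero] at h0
  exact tendsto_of_tendsto_of_tendsto_of_le_of_le' tendsto_const_nhds h0
    (Eventually.of_forall fun _ => zero_le) h

lemma numPairs_le (n : ℕ) : numPairs n ≤ (n : ℝ) ^ 2 / 2 := by
  rw [numPairs]
  have : (0 : ℝ) ≤ n := n.cast_nonneg
  nlinarith

section Law

variable {n : ℕ} {ν : Measure (Fin p → ℝ)} {ζ : ℝ} {Z : Ω → Fin n → Fin n → Fin p → ℝ}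

lemma measurable_pair_apply (hm : Measurable Z) (q : Pair n) :
    Measurable fun ω => Z ω q.1.1 q.1.2 :=
  (measurable_pi_apply q.1.2).comp ((measurable_pi_apply q.1.1).comp hm)

lemma BoundedIID.integral_comp (hm : Measurable Z) (h : BoundedIID P ν ζ Z) (q : Pair n)
    {f : (Fin p → ℝ) → ℝ} (hf : Measurable f) :
    ∫ ω, f (Z ω q.1.1 q.1.2) ∂P = ∫ z, f z ∂ν := by
  rw [← h.law q, integral_map (measurable_pair_apply hm q).aemeasurable
    hf.aestronglyMeasurable]

/-- Hoeffding's inequality for block sums, uniformly over all assignments. -/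
lemma BoundedIID.measure_exists_le_sum [IsProbabilityMeasure P] (hm : Measurable Z)
    (h : BoundedIID P ν ζ Z) (w : Fin K → Fin K → ℝ) {H : ℝ} (hw : ∀ k l, |w k l| ≤ H)
    {f : (Fin p → ℝ) → ℝ} (hf : Measurable f) {C : ℝ} (hC : ∀ z, ‖z‖ ≤ ζ → |f z| ≤ C)
    (hH : 0 < H) (hC0 : 0 < C) {t : ℝ} (ht : 0 ≤ t) :
    P {ω | ∃ e : Fin n → Fin K, t ≤ ∑ q : Pair n, w (e q.1.1) (e q.1.2) *
        (f (Z ω q.1.1 q.1.2) - ∫ z, f z ∂ν)}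
      ≤ ENNReal.ofReal ((K : ℝ) ^ n *
          Real.exp (-t ^ 2 / (2 * (numPairs n * (H * C) ^ 2)))) := by
  have key : ∀ e : Fin n → Fin K, P {ω | t ≤ ∑ q : Pair n, w (e q.1.1) (e q.1.2) *
        (f (Z ω q.1.1 q.1.2) - ∫ z, f z ∂ν)}
      ≤ ENNReal.ofReal (Real.exp (-t ^ 2 / (2 * (numPairs n * (H * C) ^ 2)))) := by
    intro e
    have hsub : ∀ q ∈ (Finset.univ : Finset (Pair n)), HasSubgaussianMGF
        (fun ω => w (e q.1.1) (e q.1.2) * (f (Z ω q.1.1 q.1.2) - ∫ z, f z ∂ν))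
        ((‖H * C - -(H * C)‖₊ / 2) ^ 2) P := by
      intro q _
      have h1 := hasSubgaussianMGF_of_mem_Icc (μ := P) (a := -(H * C)) (b := H * C)
        (X := fun ω => w (e q.1.1) (e q.1.2) * f (Z ω q.1.1 q.1.2))
        ((hf.comp (measurable_pair_apply hm q)).const_mul _).aemeasurable (by
          filter_upwards [h.ae_norm_le] with ω hω
          rw [Set.mem_Icc, ← abs_le, abs_mul]
          exact mul_le_mul (hw _ _) (hC _ (hω q)) (abs_nonneg _) hH.le)
      rw [integral_const_mul, h.integral_comp hm q hf] at h1
      simpa only [mul_sub] using h1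
    have hind : iIndepFun (fun (q : Pair n) ω => w (e q.1.1) (e q.1.2) *
        (f (Z ω q.1.1 q.1.2) - ∫ z, f z ∂ν)) P :=
      h.indep.comp (fun q z => w (e q.1.1) (e q.1.2) * (f z - ∫ z, f z ∂ν))
        fun q => (hf.sub_const _).const_mul _
    have h2 := HasSubgaussianMGF.measure_sum_ge_le_of_iIndepFun hind hsub ht
    rw [← ofReal_measureReal]
    refine ENNReal.ofReal_le_ofReal (h2.trans_eq ?_)
    congr 3
    simp only [Finset.sum_const, nsmul_eq_mul, Finset.card_univ, NNReal.coe_mul, NNReal.coe_natCast,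
      card_pair, NNReal.coe_pow, NNReal.coe_div, coe_nnnorm]
    rw [sub_neg_eq_add, Real.norm_of_nonneg (by positivity)]
    simp
  have hset : {ω | ∃ e : Fin n → Fin K, t ≤ ∑ q : Pair n, w (e q.1.1) (e q.1.2) *
        (f (Z ω q.1.1 q.1.2) - ∫ z, f z ∂ν)} = ⋃ e : Fin n → Fin K,
        {ω | t ≤ ∑ q : Pair n, w (e q.1.1) (e q.1.2) *
        (f (Z ω q.1.1 q.1.2) - ∫ z, f z ∂ν)} := by
    ext ω; simp
  rw [hset]
  refine (measure_iUnion_fintype_le P _).trans ((Finset.sum_le_sum fun e _ => key e).trans_eq ?_)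
  rw [Finset.sum_const, ENNReal.ofReal_mul (by positivity), nsmul_eq_mul]
  congr 1
  simp [ENNReal.ofReal_pow]

end Law

/-- This pays for the union bound over assignments: there are `K ^ n ≤ exp (n K)` of them, but the
Hoeffding exponent is quadratic in `n`. -/
lemma tendsto_pow_mul_exp_neg_sq (K : ℕ) {a : ℝ} (ha : 0 < a) :
    Tendsto (fun n : ℕ => (K : ℝ) ^ n * Real.exp (-(a * (n : ℝ) ^ 2))) atTop (𝓝 0) := by
  have h1 : Tendsto (fun n : ℕ => (K : ℝ) - a * n) atTop atBot :=
    tendsto_atBot_add_const_left _ _ (tendsto_neg_atTop_atBot.comp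
      (tendsto_natCast_atTop_atTop.const_mul_atTop ha))
  have h2 : Tendsto (fun n : ℕ => Real.exp ((n : ℝ) * ((K : ℝ) - a * n))) atTop (𝓝 0) :=
    Real.tendsto_exp_atBot.comp (tendsto_natCast_atTop_atTop.atTop_mul_atBot₀ h1)
  refine squeeze_zero (fun n => by positivity) (fun n => ?_) h2
  have h3 : (K : ℝ) ^ n ≤ Real.exp ((n : ℝ) * K) := by
    rw [Real.exp_nat_mul]
    gcongr
    linarith [Real.add_one_le_exp (K : ℝ)]
  calc _ ≤ Real.exp ((n : ℝ) * K) * Real.exp (-(a * (n : ℝ) ^ 2)) := by gcongr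
    _ = _ := by rw [← Real.exp_add]; ring_nf

section Seq

variable [IsProbabilityMeasure P] {ν : Measure (Fin p → ℝ)} {ζ : ℝ}
  {Z : ∀ n : ℕ, Ω → Fin n → Fin n → Fin p → ℝ}

/-- Block sums of a bounded function of the covariates concentrate, uniformly over all
assignments. -/
lemma whp_forall_abs_sum_lt (hm : ∀ n, Measurable (Z n)) (hZ : ∀ n, BoundedIID P ν ζ (Z n))
    (w : Fin K → Fin K → ℝ) {f : (Fin p → ℝ) → ℝ} (hf : Measurable f) {C : ℝ}
    (hC : ∀ z, ‖z‖ ≤ ζ → |f z| ≤ C) {δ : ℝ} (hδ : 0 < δ) :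
    Whp P fun n ω => ∀ e : Fin n → Fin K, |∑ q : Pair n, w (e q.1.1) (e q.1.2) *
        (f (Z n ω q.1.1 q.1.2) - ∫ z, f z ∂ν)| < δ * (n : ℝ) ^ 2 := by
  have one : ∀ w : Fin K → Fin K → ℝ, Whp P fun n ω => ∀ e : Fin n → Fin K,
      ∑ q : Pair n, w (e q.1.1) (e q.1.2) *
        (f (Z n ω q.1.1 q.1.2) - ∫ z, f z ∂ν) < δ * (n : ℝ) ^ 2 := by
    intro w
    -- The added `1`, here and in `C'`, gives the strict positivity that the Hoeffding bound asks
    -- for.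
    set H : ℝ := (∑ k, ∑ l, |w k l|) + 1 with hHdef
    have hH : 0 < H := by positivity
    have hw : ∀ k l, |w k l| ≤ H := by
      intro k l
      have h1 : |w k l| ≤ ∑ l, |w k l| :=
        Finset.single_le_sum (f := fun l => |w k l|) (fun _ _ => abs_nonneg _) (Finset.mem_univ l)
      have h2 : ∑ l, |w k l| ≤ ∑ k, ∑ l, |w k l| :=
        Finset.single_le_sum (f := fun k => ∑ l, |w k l|)
          (fun _ _ => Finset.sum_nonneg fun _ _ => abs_nonneg _) (Finset.mem_univ k)
      linarith
    set C' := |C| + 1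
    have hC0 : 0 < C' := by positivity
    have hC' : ∀ z, ‖z‖ ≤ ζ → |f z| ≤ C' := fun z hz =>
      (hC z hz).trans (by linarith [le_abs_self C])
    -- With `t = δ n²`, the exponent `t² / (2 N (H C')²)` is at least `(δ / (H C'))² n²` because `2
    -- N ≤ n²`.
    refine Whp.of_le (tendsto_pow_mul_exp_neg_sq K (a := (δ / (H * C')) ^ 2) (by positivity)) ?_
    filter_upwards [eventually_ge_atTop 2] with n hn
    have h1 := (hZ n).measure_exists_le_sum (hm n) w hw hf hC' hH hC0
      (t := δ * (n : ℝ) ^ 2) (by positivity)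
    have hset : {ω | ¬ ∀ e : Fin n → Fin K, ∑ q : Pair n, w (e q.1.1) (e q.1.2) *
        (f (Z n ω q.1.1 q.1.2) - ∫ z, f z ∂ν) < δ * (n : ℝ) ^ 2} =
        {ω | ∃ e : Fin n → Fin K, δ * (n : ℝ) ^ 2 ≤ ∑ q : Pair n, w (e q.1.1) (e q.1.2) *
        (f (Z n ω q.1.1 q.1.2) - ∫ z, f z ∂ν)} := by
      ext ω; simp
    rw [hset]
    refine h1.trans (ENNReal.ofReal_le_ofReal ?_)
    gcongr
    have hn2 : (2 : ℝ) ≤ n := by exact_mod_cast hn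
    have hN : 0 < numPairs n := by rw [numPairs]; nlinarith
    rw [neg_div, neg_le_neg_iff, le_div_iff₀ (by positivity)]
    calc (δ / (H * C')) ^ 2 * (n : ℝ) ^ 2 * (2 * (numPairs n * (H * C') ^ 2))
        = δ ^ 2 * (n : ℝ) ^ 2 * (2 * numPairs n) := by field_simp
      _ ≤ δ ^ 2 * (n : ℝ) ^ 2 * (n : ℝ) ^ 2 := by
        gcongr
        linarith [numPairs_le n]
      _ = _ := by ring
  -- Negated weights supply the lower tail.
  refine ((one w).and (one fun k l => -w k l)).mono (Eventually.of_forall fun n ω h e => ?_)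
  have h1 := h.1 e
  have h2 := h.2 e
  simp only [neg_mul, Finset.sum_neg_distrib] at h2
  rw [abs_lt]
  constructor <;> linarith

/-- Weighted sums of the entries of `A` concentrate around the sums of the rates. -/
lemma whp_abs_sum_sub_rate_lt {π : Fin K → ℝ} {B : Matrix (Fin K) (Fin K) ℝ}
    (hB : ∀ a b, 0 ≤ B a b) {ρ : ℕ → ℝ} (hρ : ∀ n, 0 < ρ n) {γ₀ : Fin p → ℝ}
    {c : ∀ n : ℕ, Ω → Fin n → Fin K} {A : ∀ n : ℕ, Ω → Fin n → Fin n → ℕ}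
    (hmodel : ∀ n, IsPCABM P π (ρ n • B) γ₀ (c n) (Z n) (A n))
    (hZ : ∀ n, BoundedIID P ν ζ (Z n))
    (hNρ : Tendsto (fun n : ℕ => numPairs n * ρ n) atTop atTop)
    {g : (Fin p → ℝ) → ℝ} (hg : Measurable g) {C : ℝ} (hgC : ∀ z, ‖z‖ ≤ ζ → |g z| ≤ C)
    {δ : ℝ} (hδ : 0 < δ) :
    Whp P fun n ω => |∑ q : Pair n, g (Z n ω q.1.1 q.1.2) *
      ((A n ω q.1.1 q.1.2 : ℝ) - rate (ρ n • B) γ₀ (c n ω) (Z n ω) q.1.1 q.1.2)|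
        < δ * (numPairs n * ρ n) := by
  set b : ℝ := ∑ k, ∑ l, B k l with hb_def
  have hb : ∀ k l, B k l ≤ b := fun k l =>
    (Finset.single_le_sum (f := fun l => B k l) (fun _ _ => hB _ _) (Finset.mem_univ l)).trans
      (Finset.single_le_sum (f := fun k => ∑ l, B k l)
        (fun _ _ => Finset.sum_nonneg fun _ _ => hB _ _) (Finset.mem_univ k))
  set D : ℝ := C ^ 2 * (b * Real.exp (p * ζ * ‖γ₀‖)) / δ ^ 2 with hD
  -- A variance of order `N ρ` over the squared threshold `(δ N ρ)²`.
  have hlim : Tendsto (fun n => D / (numPairs n * ρ n)) atTop (𝓝 0) :=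
    hNρ.const_div_atTop D
  refine Whp.of_le hlim ?_
  filter_upwards [hNρ.eventually_gt_atTop 0] with n hn
  have h1 := (hmodel n).measure_le_abs_sum
    (fun k l => mul_nonneg (hρ n).le (hB k l)) (hZ n) hg hgC (b := ρ n * b)
    (fun k l => mul_le_mul_of_nonneg_left (hb k l) (hρ n).le)
    (t := δ * (numPairs n * ρ n)) (by positivity)
  simp only [not_lt]
  refine h1.trans_eq ?_
  congr 1
  have hN : numPairs n ≠ 0 := by rintro h; simp [h] at hn
  have hρ' := (hρ n).ne'
  rw [hD]
  field_simp

/-- Hoeffding applied to `-1(c_i = a)`, negated so that the upper-tail bound controls small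
communities. The range `[-1, 0]` has sub-Gaussian parameter `1/4`, whence the exponent. -/
lemma IsPCABM.measure_commSize_lt {n : ℕ} {π : Fin K → ℝ} {B : Matrix (Fin K) (Fin K) ℝ}
    {γ₀ : Fin p → ℝ} {c : Ω → Fin n → Fin K} {Z : Ω → Fin n → Fin n → Fin p → ℝ}
    {A : Ω → Fin n → Fin n → ℕ} (h : IsPCABM P π B γ₀ c Z A) (a : Fin K) (ha : 0 < π a)
    (hn : 0 < n) :
    P {ω | ¬ π a / 2 * n ≤ (commSize (c ω) a : ℝ)}
      ≤ ENNReal.ofReal (Real.exp (-(π a ^ 2 / 2 * n))) := by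
  have hc : ∀ i, Measurable fun ω => c ω i := fun i =>
    (measurable_pi_apply i).comp h.measurable_c
  let f : Fin K → ℝ := fun k => if k = a then -1 else 0
  have hf : Measurable f := measurable_of_countable _
  have hint : ∀ i, ∫ ω, f (c ω i) ∂P = -π a := by
    intro i
    have hs : MeasurableSet {ω | c ω i = a} := hc i (measurableSet_singleton a)
    have : (fun ω => f (c ω i)) = {ω | c ω i = a}.indicator fun _ => (-1 : ℝ) := by
      ext ω; simp [f, Set.indicator_apply]
    rw [this, integral_indicator_const _ hs, h.law_c]
    simp
  have hsub : ∀ i ∈ (Finset.univ : Finset (Fin n)), HasSubgaussianMGF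
      (fun ω => f (c ω i) + π a) ((‖(0 : ℝ) - -1‖₊ / 2) ^ 2) P := by
    intro i _
    have h1 := hasSubgaussianMGF_of_mem_Icc (μ := P) (a := (-1 : ℝ)) (b := 0)
      (X := fun ω => f (c ω i)) (hf.comp (hc i)).aemeasurable
      (ae_of_all _ fun ω => by
        by_cases hk : c ω i = a <;> simp [f, hk])
    rw [hint] at h1
    simpa only [sub_neg_eq_add] using h1
  have hind : iIndepFun (fun i ω => f (c ω i) + π a) P :=
    h.indep_c.comp (fun i k => f k + π a) fun i => hf.add_const _
  have h2 := HasSubgaussianMGF.measure_sum_ge_le_of_iIndepFun hind hsub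
    (ε := π a / 2 * n) (by positivity)
  rw [← ofReal_measureReal]
  refine ENNReal.ofReal_le_ofReal (le_trans ?_ (h2.trans_eq ?_))
  · refine measureReal_mono fun ω hω => ?_
    have hω' : ¬ π a / 2 * n ≤ (commSize (c ω) a : ℝ) := hω
    have hsum : ∑ i, (f (c ω i) + π a) = -(commSize (c ω) a : ℝ) + n * π a := by
      have h3 : ∑ i, f (c ω i) = -(commSize (c ω) a : ℝ) := by
        simp only [f, commSize]
        rw [← Finset.sum_filter]
        simp
      rw [Finset.sum_add_distrib, h3]
      simp
    change π a / 2 * n ≤ ∑ i, (f (c ω i) + π a)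
    rw [hsum]
    linarith
  · congr 1
    have hn' : (n : ℝ) ≠ 0 := by exact_mod_cast hn.ne'
    simp
    field_simp

lemma whp_le_commSize {π : Fin K → ℝ} {B : ℕ → Matrix (Fin K) (Fin K) ℝ} {γ₀ : Fin p → ℝ}
    {c : ∀ n : ℕ, Ω → Fin n → Fin K} {A : ∀ n : ℕ, Ω → Fin n → Fin n → ℕ}
    (hmodel : ∀ n, IsPCABM P π (B n) γ₀ (c n) (Z n) (A n)) (a : Fin K) (ha : 0 < π a) :
    Whp P fun n ω => π a / 2 * n ≤ (commSize (c n ω) a : ℝ) := by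
  have hlim : Tendsto (fun n : ℕ => Real.exp (-(π a ^ 2 / 2 * n))) atTop (𝓝 0) :=
    Real.tendsto_exp_neg_atTop_nhds_zero.comp
      (tendsto_natCast_atTop_atTop.const_mul_atTop (by positivity))
  refine Whp.of_le hlim ?_
  filter_upwards [eventually_gt_atTop 0] with n hn
  exact (hmodel n).measure_commSize_lt a ha hn

end Seq

end PCABM

/-! ### Deterministic properties of the profile log-likelihood. -/

namespace PCABM

/-- Normalize the exponentials at `x` and at `y` to sum to `1`, apply convexity of `exp` termwise
and add up: the bound becomes `a + b = 1`. For empty `s` the function is constant, as `log 0 = 0`.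
-/
lemma convexOn_log_sum_exp_dotProduct {ι : Type*} {p : ℕ} (s : Finset ι) (v : ι → Fin p → ℝ) :
    ConvexOn ℝ Set.univ fun γ : Fin p → ℝ => Real.log (∑ i ∈ s, Real.exp (v i ⬝ᵥ γ)) := by
  refine ⟨convex_univ, fun x _ y _ a b ha hb hab => ?_⟩
  rcases s.eq_empty_or_nonempty with rfl | hs
  · simp
  have hpos : ∀ γ, 0 < ∑ i ∈ s, Real.exp (v i ⬝ᵥ γ) := fun γ =>
    Finset.sum_pos (fun _ _ => Real.exp_pos _) hs
  set X := ∑ i ∈ s, Real.exp (v i ⬝ᵥ x) with hX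
  set Y := ∑ i ∈ s, Real.exp (v i ⬝ᵥ y) with hY
  have hX0 : 0 < X := hpos x
  have hY0 : 0 < Y := hpos y
  simp only [smul_eq_mul]
  rw [Real.log_le_iff_le_exp (hpos _)]
  have hterm : ∀ i ∈ s, Real.exp (v i ⬝ᵥ (a • x + b • y)) ≤
      Real.exp (a * Real.log X + b * Real.log Y) *
        (a * (Real.exp (v i ⬝ᵥ x) / X) + b * (Real.exp (v i ⬝ᵥ y) / Y)) := by
    intro i _
    have h1 := convexOn_exp.2 (Set.mem_univ (v i ⬝ᵥ x - Real.log X))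
      (Set.mem_univ (v i ⬝ᵥ y - Real.log Y)) ha hb hab
    simp only [smul_eq_mul, Real.exp_sub, Real.exp_log hX0, Real.exp_log hY0] at h1
    refine le_trans (le_of_eq ?_) (mul_le_mul_of_nonneg_left h1 (Real.exp_nonneg _))
    rw [← Real.exp_add, dotProduct_add, dotProduct_smul, dotProduct_smul, smul_eq_mul, smul_eq_mul]
    ring_nf
  refine (Finset.sum_le_sum hterm).trans_eq ?_
  rw [← Finset.mul_sum, Finset.sum_add_distrib, ← Finset.mul_sum, ← Finset.mul_sum,
    ← Finset.sum_div, ← Finset.sum_div, ← hX, ← hY, div_self hX0.ne', div_self hY0.ne']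
  simp [hab]

/-- A concave function that is smaller on a sphere than at its center has a maximizer, and every
maximizer lies inside the sphere. -/
lemma exists_forall_le_of_lt_on_sphere {p : ℕ} {g : (Fin p → ℝ) → ℝ}
    (hg : ConcaveOn ℝ Set.univ g) {x₀ : Fin p → ℝ} {ε : ℝ} (hε : 0 < ε)
    (h : ∀ x, ‖x - x₀‖ = ε → g x < g x₀) :
    (∃ x, ∀ y, g y ≤ g x) ∧ ∀ x, (∀ y, g y ≤ g x) → ‖x - x₀‖ < ε := by
  -- The segment from `x₀` to `x` meets the sphere at some `y`, where `(1 - t) g x₀ + t g x ≤ g y <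
  -- g x₀`.
  have hout : ∀ x, ε ≤ ‖x - x₀‖ → g x < g x₀ := by
    intro x hx
    have hd : 0 < ‖x - x₀‖ := hε.trans_le hx
    set t := ε / ‖x - x₀‖ with ht
    have ht0 : 0 < t := by positivity
    have ht1 : t ≤ 1 := (div_le_one hd).2 hx
    have hy : ‖((1 - t) • x₀ + t • x) - x₀‖ = ε := by
      have : ((1 - t) • x₀ + t • x) - x₀ = t • (x - x₀) := by
        rw [sub_smul, smul_sub, one_smul]; abel
      rw [this, norm_smul, Real.norm_of_nonneg ht0.le, ht, div_mul_cancel₀ _ hd.ne']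
    have h1 := h _ hy
    have h2 := hg.2 (Set.mem_univ x₀) (Set.mem_univ x) (sub_nonneg.2 ht1) ht0.le
      (sub_add_cancel 1 t)
    simp only [smul_eq_mul] at h2
    nlinarith
  have hcont : Continuous g := continuousOn_univ.1 (hg.continuousOn isOpen_univ)
  obtain ⟨x, -, hx⟩ := (isCompact_closedBall x₀ ε).exists_isMaxOn
    ⟨x₀, Metric.mem_closedBall_self hε.le⟩ hcont.continuousOn
  refine ⟨⟨x, fun y => ?_⟩, fun x hx => ?_⟩
  · by_cases hy : y ∈ Metric.closedBall x₀ ε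
    · exact hx hy
    · rw [Metric.mem_closedBall, dist_eq_norm, not_le] at hy
      exact (hout y hy.le).le.trans (hx (Metric.mem_closedBall_self hε.le))
  · by_contra hcon
    exact absurd (hx x₀) (not_le.2 (hout x (not_lt.1 hcon)))

variable {n K p : ℕ} {Z : Fin n → Fin n → Fin p → ℝ} {A : Fin n → Fin n → ℕ}
  {e : Fin n → Fin K} {k l : Fin K}

lemma blockExp_eq_sum_filter (γ : Fin p → ℝ) :
    blockExp Z e γ k l = ∑ x ∈ (Finset.univ : Finset (Fin n × Fin n)).filter
      (fun x => x.1 ≠ x.2 ∧ e x.1 = k ∧ e x.2 = l), Real.exp (Z x.1 x.2 ⬝ᵥ γ) := by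
  rw [Finset.sum_filter, Fintype.sum_prod_type]
  rfl

lemma concaveOn_profileLogLik : ConcaveOn ℝ Set.univ (profileLogLik A Z e) := by
  have hconv : ∀ k l, ConvexOn ℝ Set.univ fun γ => Real.log (blockExp Z e γ k l) := by
    intro k l
    simp only [blockExp_eq_sum_filter]
    exact convexOn_log_sum_exp_dotProduct _ _
  have hO : ∀ k l, 0 ≤ blockEdges A e k l := fun k l =>
    Finset.sum_nonneg fun i _ => Finset.sum_nonneg fun j _ => by split_ifs <;> simp
  refine ⟨convex_univ, fun x _ y _ a b ha hb hab => ?_⟩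
  simp only [profileLogLik, smul_eq_mul]
  have h1 : ∑ q : Pair n, (A q.1.1 q.1.2 : ℝ) * (Z q.1.1 q.1.2 ⬝ᵥ (a • x + b • y))
      = a * ∑ q : Pair n, (A q.1.1 q.1.2 : ℝ) * (Z q.1.1 q.1.2 ⬝ᵥ x)
        + b * ∑ q : Pair n, (A q.1.1 q.1.2 : ℝ) * (Z q.1.1 q.1.2 ⬝ᵥ y) := by
    rw [Finset.mul_sum, Finset.mul_sum, ← Finset.sum_add_distrib]
    refine Finset.sum_congr rfl fun q _ => ?_
    rw [dotProduct_add, dotProduct_smul, dotProduct_smul, smul_eq_mul, smul_eq_mul]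
    ring
  have h2 : ∑ k, ∑ l, blockEdges A e k l * Real.log (blockExp Z e (a • x + b • y) k l)
      ≤ a * ∑ k, ∑ l, blockEdges A e k l * Real.log (blockExp Z e x k l)
        + b * ∑ k, ∑ l, blockEdges A e k l * Real.log (blockExp Z e y k l) := by
    simp only [Finset.mul_sum, ← Finset.sum_add_distrib]
    refine Finset.sum_le_sum fun k _ => Finset.sum_le_sum fun l _ => ?_
    have h3 := mul_le_mul_of_nonneg_left ((hconv k l).2 (Set.mem_univ x) (Set.mem_univ y) ha hb hab)
      (hO k l)
    simp only [smul_eq_mul] at h3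
    linarith
  rw [h1]
  linarith

/-- Multiplicity of an unordered pair with labels `a, b` in the ordered block `(k, l)`. -/
def blockWeight (k l a b : Fin K) : ℝ :=
  (if a = k ∧ b = l then 1 else 0) + (if b = k ∧ a = l then 1 else 0)

/-- The number of ordered pairs of distinct nodes in the block `(k, l)`. -/
def blockCount (e : Fin n → Fin K) (k l : Fin K) : ℝ :=
  ∑ q : Pair n, blockWeight k l (e q.1.1) (e q.1.2)

lemma blockExp_eq_sum_pair (hZ : ∀ i j, Z i j = Z j i) (γ : Fin p → ℝ) :
    blockExp Z e γ k l = ∑ q : Pair n, blockWeight k l (e q.1.1) (e q.1.2) *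
      Real.exp (Z q.1.1 q.1.2 ⬝ᵥ γ) := by
  rw [blockExp, sum_sum_eq_sum_pair _ (by simp)]
  refine Finset.sum_congr rfl fun q _ => ?_
  have h1 : q.1.1 ≠ q.1.2 := q.2.ne
  rw [hZ q.1.2 q.1.1]
  simp only [ne_eq, h1, h1.symm, not_false_eq_true, true_and, blockWeight, add_mul, ite_mul, one_mul,
    zero_mul]

/-- The product also counts diagonal pairs, of which there are at most `n`. -/
lemma blockCount_ge : (commSize e k : ℝ) * commSize e l - n ≤ blockCount e k l := by
  have h1 : blockCount e k l
      = ∑ i, ∑ j, if i ≠ j ∧ e i = k ∧ e j = l then (1 : ℝ) else 0 := by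
    rw [sum_sum_eq_sum_pair _ (by simp)]
    refine Finset.sum_congr rfl fun q _ => ?_
    have h1 : q.1.1 ≠ q.1.2 := q.2.ne
    simp [h1, h1.symm, blockWeight]
  have h2 : (commSize e k : ℝ) * commSize e l
      = ∑ i, ∑ j, (if e i = k then (1 : ℝ) else 0) * (if e j = l then 1 else 0) := by
    rw [← Finset.sum_mul_sum]
    simp [commSize]
  have h3 : (n : ℝ) = ∑ i : Fin n, ∑ j : Fin n, if i = j then (1 : ℝ) else 0 := by simp
  rw [h1, h2, h3, ← Finset.sum_sub_distrib]
  refine Finset.sum_le_sum fun i _ => ?_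
  rw [← Finset.sum_sub_distrib]
  refine Finset.sum_le_sum fun j _ => ?_
  by_cases hij : i = j <;> by_cases hi : e i = k <;> by_cases hj : e j = l <;> simp_all

lemma blockCount_ge_of_commSize_ge {a b : ℝ} (ha : 0 < a) (hb : 0 < b)
    (hn : 2 / (a * b) ≤ n) (hk : a * n ≤ commSize e k) (hl : b * n ≤ commSize e l) :
    a * b / 2 * (n : ℝ) ^ 2 ≤ blockCount e k l := by
  refine le_trans ?_ blockCount_ge
  have h1 : a * n * (b * n) ≤ (commSize e k : ℝ) * commSize e l :=
    mul_le_mul hk hl (by positivity) (by positivity)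
  rw [div_le_iff₀ (by positivity)] at hn
  have h2 : (0 : ℝ) ≤ n := n.cast_nonneg
  nlinarith

/-- Exchanging sums evaluates each block logarithm at the labels of the endpoints. Values at two
parameters can then be compared edge by edge, with nonnegative weights `A_ij`. -/
lemma profileLogLik_eq_sum_pair (hA : ∀ i j, A i j = A j i) (hA0 : ∀ i, A i i = 0)
    (γ : Fin p → ℝ) :
    profileLogLik A Z e γ = ∑ q : Pair n, (A q.1.1 q.1.2 : ℝ) * (Z q.1.1 q.1.2 ⬝ᵥ γ
      - (Real.log (blockExp Z e γ (e q.1.1) (e q.1.2))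
        + Real.log (blockExp Z e γ (e q.1.2) (e q.1.1))) / 2) := by
  have h1 : ∑ k, ∑ l, blockEdges A e k l * Real.log (blockExp Z e γ k l)
      = ∑ i, ∑ j, (A i j : ℝ) * Real.log (blockExp Z e γ (e i) (e j)) := by
    simp only [blockEdges, Finset.sum_mul, ite_mul, zero_mul]
    calc _ = ∑ k, ∑ i, ∑ l, ∑ j, (if e i = k ∧ e j = l then
            (A i j : ℝ) * Real.log (blockExp Z e γ k l) else 0) :=
          Finset.sum_congr rfl fun k _ => Finset.sum_comm
      _ = ∑ i, ∑ k, ∑ j, ∑ l, (if e i = k ∧ e j = l then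
            (A i j : ℝ) * Real.log (blockExp Z e γ k l) else 0) := by
          rw [Finset.sum_comm]
          exact Finset.sum_congr rfl fun i _ => Finset.sum_congr rfl fun k _ => Finset.sum_comm
      _ = _ := by
          refine Finset.sum_congr rfl fun i _ => ?_
          rw [Finset.sum_comm]
          refine Finset.sum_congr rfl fun j _ => ?_
          simp [ite_and]
  rw [profileLogLik, h1, sum_sum_eq_sum_pair _ (by simp [hA0]), Finset.mul_sum,
    ← Finset.sum_sub_distrib]
  refine Finset.sum_congr rfl fun q _ => ?_
  rw [hA q.1.2 q.1.1]
  ring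

/-- Each exponential changes by a factor at most `exp (p ζ ‖γ - γ'‖)`, hence so does their sum. The
Lipschitz constant is free of `n` and `e`, which lets estimates at one point extend to a fixed ball.
In an empty block both logarithms are `log 0 = 0`. -/
lemma log_blockExp_sub_le {ζ : ℝ} (hζ : 0 ≤ ζ) (hZ : ∀ i j, Z i j = Z j i)
    (hb : ∀ q : Pair n, ‖Z q.1.1 q.1.2‖ ≤ ζ) (γ γ' : Fin p → ℝ) :
    Real.log (blockExp Z e γ k l) - Real.log (blockExp Z e γ' k l) ≤ p * ζ * ‖γ - γ'‖ := by
  have hd : 0 ≤ p * ζ * ‖γ - γ'‖ := by positivity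
  have hw : ∀ a b, 0 ≤ blockWeight k l a b := fun a b => by
    unfold blockWeight; positivity
  have hle : blockExp Z e γ k l ≤ Real.exp (p * ζ * ‖γ - γ'‖) * blockExp Z e γ' k l := by
    rw [blockExp_eq_sum_pair hZ, blockExp_eq_sum_pair hZ, Finset.mul_sum]
    refine Finset.sum_le_sum fun q _ => ?_
    rw [mul_left_comm, ← Real.exp_add]
    refine mul_le_mul_of_nonneg_left (Real.exp_le_exp.2 ?_) (hw _ _)
    have h1 := (le_abs_self _).trans (abs_dotProduct_le (hb q) (γ - γ'))
    rw [dotProduct_sub] at h1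
    linarith
  have h0 : ∀ γ, 0 ≤ blockExp Z e γ k l := fun γ => by
    rw [blockExp_eq_sum_filter]; exact Finset.sum_nonneg fun _ _ => Real.exp_nonneg _
  rcases (h0 γ).eq_or_lt' with h | h
  · rcases Finset.eq_empty_or_nonempty ((Finset.univ : Finset (Fin n × Fin n)).filter
      (fun x => x.1 ≠ x.2 ∧ e x.1 = k ∧ e x.2 = l)) with hs | hs
    · simpa [blockExp_eq_sum_filter, hs] using hd
    · rw [blockExp_eq_sum_filter] at h
      exact absurd h (Finset.sum_pos (fun _ _ => Real.exp_pos _) hs).ne'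
  · have h' : 0 < blockExp Z e γ' k l := by
      by_contra hcon
      have : blockExp Z e γ' k l = 0 := le_antisymm (not_lt.1 hcon) (h0 γ')
      rw [this, mul_zero] at hle
      linarith
    have h2 := Real.log_le_log h hle
    rw [Real.log_mul (Real.exp_pos _).ne' h'.ne', Real.log_exp] at h2
    linarith

/-- Apply `log t ≤ t - 1` to `x / y` and `y / x`; `s ≤ 1 / 2` gives `s / (1 - s) ≤ 2 s`. -/
lemma abs_log_sub_log_le {x y s : ℝ} (hy : 0 < y) (hs : s ≤ 1 / 2) (h : |x - y| ≤ s * y) :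
    |Real.log x - Real.log y| ≤ 2 * s := by
  have hs0 : 0 ≤ s := nonneg_of_mul_nonneg_left ((abs_nonneg _).trans h) hy
  rw [abs_le] at h
  have hx : 0 < x := by nlinarith
  rw [abs_le]
  constructor
  · have h1 := Real.log_le_sub_one_of_pos (div_pos hy hx)
    rw [Real.log_div hy.ne' hx.ne'] at h1
    have h2 : y / x - 1 ≤ 2 * s := by
      rw [sub_le_iff_le_add, div_le_iff₀ hx]
      nlinarith
    linarith
  · have h1 := Real.log_le_sub_one_of_pos (div_pos hx hy)
    rw [Real.log_div hx.ne' hy.ne'] at h1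
    have h2 : x / y - 1 ≤ 2 * s := by
      rw [sub_le_iff_le_add, div_le_iff₀ hy]
      nlinarith
    linarith

end PCABM

/-! ### Identifiability in the covariate law. -/

namespace PCABM

variable {p : ℕ} {ν : Measure (Fin p → ℝ)} {ζ : ℝ}

lemma BoundedIID.isProbabilityMeasure {Ω : Type*} [MeasurableSpace Ω] {P : Measure Ω}
    [IsProbabilityMeasure P] {n : ℕ} {Z : Ω → Fin n → Fin n → Fin p → ℝ} (hm : Measurable Z)
    (h : BoundedIID P ν ζ Z) (q : Pair n) :
    IsProbabilityMeasure ν ∧ ∀ᵐ z ∂ν, ‖z‖ ≤ ζ := by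
  have hq := (measurable_pair_apply hm q).aemeasurable (μ := P)
  rw [← h.law q]
  refine ⟨Measure.isProbabilityMeasure_map hq, ?_⟩
  rw [ae_map_iff hq (measurableSet_le measurable_norm measurable_const)]
  exact h.bounded q

lemma integrable_of_bounded_on [IsFiniteMeasure ν] (hν : ∀ᵐ z ∂ν, ‖z‖ ≤ ζ)
    {f : (Fin p → ℝ) → ℝ} (hf : Measurable f) {C : ℝ} (hC : ∀ z, ‖z‖ ≤ ζ → |f z| ≤ C) :
    Integrable f ν :=
  Integrable.of_bound hf.aestronglyMeasurable C (hν.mono fun z hz => hC z hz)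

lemma measurable_exp_dotProduct (γ : Fin p → ℝ) :
    Measurable fun z : Fin p → ℝ => Real.exp (z ⬝ᵥ γ) :=
  Real.measurable_exp.comp (measurable_dotProduct_right γ)

lemma abs_exp_dotProduct_le {z : Fin p → ℝ} (hz : ‖z‖ ≤ ζ) (γ : Fin p → ℝ) :
    |Real.exp (z ⬝ᵥ γ)| ≤ Real.exp (p * ζ * ‖γ‖) := by
  rw [abs_of_pos (Real.exp_pos _)]
  exact Real.exp_le_exp.2 ((le_abs_self _).trans (abs_dotProduct_le hz γ))

lemma theta_pos [IsProbabilityMeasure ν] (hν : ∀ᵐ z ∂ν, ‖z‖ ≤ ζ) (γ : Fin p → ℝ) :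
    0 < theta ν γ :=
  integral_exp_pos (integrable_of_bounded_on hν (measurable_exp_dotProduct γ)
    fun _ hz => abs_exp_dotProduct_le hz γ)

/-- If `zᵀu` is almost surely constant, `u` lies in the kernel of
`Σ(γ) - θ(γ)⁻¹ μ(γ) μ(γ)ᵀ`. -/
lemma mulVec_eq_zero_of_ae_eq_const [IsProbabilityMeasure ν] (hν : ∀ᵐ z ∂ν, ‖z‖ ≤ ζ)
    (γ u : Fin p → ℝ) {L : ℝ} (h : ∀ᵐ z ∂ν, z ⬝ᵥ u = L) :
    (sigmaMat ν γ - (theta ν γ)⁻¹ • vecMulVec (muVec ν γ) (muVec ν γ)) *ᵥ u = 0 := by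
  have hθ := theta_pos hν γ
  have hcoord : ∀ (z : Fin p → ℝ) r, ‖z‖ ≤ ζ → |z r| ≤ ζ :=
    fun z r hz => (norm_le_pi_norm z r).trans hz
  have hint1 : ∀ r, Integrable (fun z : Fin p → ℝ => z r * Real.exp (z ⬝ᵥ γ)) ν := fun r =>
    integrable_of_bounded_on hν ((measurable_pi_apply r).mul (measurable_exp_dotProduct γ))
      (C := ζ * Real.exp (p * ζ * ‖γ‖)) fun z hz => by
        rw [abs_mul]
        exact mul_le_mul (hcoord z r hz) (abs_exp_dotProduct_le hz γ) (abs_nonneg _)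
          ((abs_nonneg _).trans (hcoord z r hz))
  have hint2 : ∀ r s, Integrable (fun z : Fin p → ℝ => z r * z s * Real.exp (z ⬝ᵥ γ)) ν :=
    fun r s => integrable_of_bounded_on hν
      (((measurable_pi_apply r).mul (measurable_pi_apply s)).mul (measurable_exp_dotProduct γ))
      (C := ζ * ζ * Real.exp (p * ζ * ‖γ‖)) fun z hz => by
        have h0 := (abs_nonneg _).trans (hcoord z r hz)
        rw [abs_mul, abs_mul]
        exact mul_le_mul (mul_le_mul (hcoord z r hz) (hcoord z s hz) (abs_nonneg _) h0)
          (abs_exp_dotProduct_le hz γ) (abs_nonneg _) (mul_nonneg h0 h0)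
  -- Replacing `zᵀu` by `L` inside the integrals gives `μᵀu = L θ` and `Σ u = L μ`, so the two terms
  -- of the matrix cancel on `u`.
  have hμ : muVec ν γ ⬝ᵥ u = L * theta ν γ := by
    change ∑ r, (∫ z, z r * Real.exp (z ⬝ᵥ γ) ∂ν) * u r = L * ∫ z, Real.exp (z ⬝ᵥ γ) ∂ν
    simp only [← integral_mul_const, ← integral_const_mul]
    rw [← integral_finsetSum _ fun r _ => (hint1 r).mul_const _]
    refine integral_congr_ae (h.mono fun z hz => ?_)
    simp only [dotProduct] at hz
    simp only [mul_right_comm _ (Real.exp _), ← Finset.sum_mul, hz]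
  have hσ : sigmaMat ν γ *ᵥ u = L • muVec ν γ := by
    ext r
    change ∑ s, (∫ z, z r * z s * Real.exp (z ⬝ᵥ γ) ∂ν) * u s
      = L * ∫ z, z r * Real.exp (z ⬝ᵥ γ) ∂ν
    simp only [← integral_mul_const, ← integral_const_mul]
    rw [← integral_finsetSum _ fun s _ => (hint2 r s).mul_const _]
    refine integral_congr_ae (h.mono fun z hz => ?_)
    simp only [dotProduct] at hz
    simp only [← hz, Finset.sum_mul]
    exact Finset.sum_congr rfl fun s _ => by ring
  rw [sub_mulVec, hσ, smul_mulVec, vecMulVec_mulVec, hμ]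
  ext r
  simp
  field_simp
  simp

/-- The log-likelihood ratio weight of a covariate. -/
noncomputable def tilt (ν : Measure (Fin p → ℝ)) (γ₀ γ z : Fin p → ℝ) : ℝ :=
  z ⬝ᵥ (γ - γ₀) - (Real.log (theta ν γ) - Real.log (theta ν γ₀))

lemma measurable_tilt (γ₀ γ : Fin p → ℝ) : Measurable (tilt ν γ₀ γ) :=
  (measurable_dotProduct_right _).sub_const _

lemma abs_tilt_le (γ₀ γ : Fin p → ℝ) {z : Fin p → ℝ} (hz : ‖z‖ ≤ ζ) :
    |tilt ν γ₀ γ z|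
      ≤ p * ζ * ‖γ - γ₀‖ + |Real.log (theta ν γ) - Real.log (theta ν γ₀)| :=
  (abs_sub _ _).trans (add_le_add_left (abs_dotProduct_le hz _) _)

/-- Identifiability: the expected log-likelihood ratio is negative away from the truth. -/
lemma integral_exp_mul_tilt_neg [IsProbabilityMeasure ν] (hν : ∀ᵐ z ∂ν, ‖z‖ ≤ ζ)
    {γ₀ γ : Fin p → ℝ} (hne : γ ≠ γ₀)
    (hpd : (sigmaMat ν γ₀ -
      (theta ν γ₀)⁻¹ • vecMulVec (muVec ν γ₀) (muVec ν γ₀)).PosDef) :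
    ∫ z, Real.exp (z ⬝ᵥ γ₀) * tilt ν γ₀ γ z ∂ν < 0 := by
  have hθ := theta_pos hν γ
  have hθ₀ := theta_pos hν γ₀
  have hi0 : Integrable (fun z => Real.exp (z ⬝ᵥ γ₀)) ν :=
    integrable_of_bounded_on hν (measurable_exp_dotProduct γ₀)
      fun _ hz => abs_exp_dotProduct_le hz γ₀
  have hi1 : Integrable (fun z => Real.exp (z ⬝ᵥ γ)) ν :=
    integrable_of_bounded_on hν (measurable_exp_dotProduct γ)
      fun _ hz => abs_exp_dotProduct_le hz γ
  have hi2 : Integrable (fun z => Real.exp (z ⬝ᵥ γ₀) * tilt ν γ₀ γ z) ν :=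
    integrable_of_bounded_on hν
      ((measurable_exp_dotProduct γ₀).mul (measurable_tilt γ₀ γ)) fun z hz => by
        rw [abs_mul]
        exact mul_le_mul (abs_exp_dotProduct_le hz γ₀) (abs_tilt_le γ₀ γ hz) (abs_nonneg _)
          (Real.exp_nonneg _)
  have hexp : ∀ z : Fin p → ℝ, Real.exp (z ⬝ᵥ γ₀) * Real.exp (tilt ν γ₀ γ z)
      = Real.exp (z ⬝ᵥ γ) * (theta ν γ₀ / theta ν γ) := by
    intro z
    have : theta ν γ₀ / theta ν γ
        = Real.exp (Real.log (theta ν γ₀) - Real.log (theta ν γ)) := by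
      rw [Real.exp_sub, Real.exp_log hθ, Real.exp_log hθ₀]
    rw [this, ← Real.exp_add, ← Real.exp_add, tilt, dotProduct_sub]
    ring_nf
  -- `G = exp(zᵀγ₀) (exp t - 1 - t) ≥ 0` with `t` the tilt. Its first two terms both integrate to
  -- `±θ(γ₀)`, so its integral is minus the one to be bounded.
  set G : (Fin p → ℝ) → ℝ := fun z =>
    Real.exp (z ⬝ᵥ γ₀) * Real.exp (tilt ν γ₀ γ z)
      - Real.exp (z ⬝ᵥ γ₀) - Real.exp (z ⬝ᵥ γ₀) * tilt ν γ₀ γ z with hG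
  have hi3 : Integrable (fun z => Real.exp (z ⬝ᵥ γ₀) * Real.exp (tilt ν γ₀ γ z)) ν := by
    simp only [hexp]
    exact hi1.mul_const _
  have hGint : Integrable G ν := (hi3.sub hi0).sub hi2
  have hG0 : ∀ z, 0 ≤ G z := fun z => by
    have h1 := Real.add_one_le_exp (tilt ν γ₀ γ z)
    have h2 := Real.exp_pos (z ⬝ᵥ γ₀)
    simp only [hG]
    nlinarith
  have hval : ∫ z, G z ∂ν = -∫ z, Real.exp (z ⬝ᵥ γ₀) * tilt ν γ₀ γ z ∂ν := by
    have h1 : ∫ z, Real.exp (z ⬝ᵥ γ₀) * Real.exp (tilt ν γ₀ γ z) ∂ν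
        = ∫ z, Real.exp (z ⬝ᵥ γ₀) ∂ν := by
      simp only [hexp]
      rw [integral_mul_const]
      change theta ν γ * (theta ν γ₀ / theta ν γ) = theta ν γ₀
      field_simp
    have h2 := integral_sub (hi3.sub hi0) hi2
    simp only [Pi.sub_apply] at h2
    rw [integral_sub hi3 hi0, h1] at h2
    rw [hG, h2]
    ring
  rcases (integral_nonneg (μ := ν) (show 0 ≤ G from hG0)).eq_or_lt' with h0 | hpos
  · exfalso
    -- Equality forces the tilt to vanish almost everywhere, so `zᵀ(γ - γ₀)` is constant,
    -- contradicting positive definiteness.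
    have hae := (integral_eq_zero_iff_of_nonneg (show 0 ≤ G from hG0) hGint).1 h0
    have hconst : ∀ᵐ z ∂ν,
        z ⬝ᵥ (γ - γ₀) = Real.log (theta ν γ) - Real.log (theta ν γ₀) := by
      filter_upwards [hae] with z hz
      by_contra hcon
      have h1 := Real.add_one_lt_exp (x := tilt ν γ₀ γ z) (sub_ne_zero.2 hcon)
      have h2 := Real.exp_pos (z ⬝ᵥ γ₀)
      simp only [hG, Pi.zero_apply] at hz
      nlinarith
    have hker := mulVec_eq_zero_of_ae_eq_const hν γ₀ (γ - γ₀) hconst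
    have := hpd.dotProduct_mulVec_pos (sub_ne_zero.2 hne)
    rw [hker] at this
    simp at this
  · linarith

end PCABM

/-! ### Comparison of the profile log-likelihood at `γ` and at `γ₀`. -/

namespace PCABM

section Consistency

variable {Ω : Type*} [MeasurableSpace Ω] {P : Measure Ω} [IsProbabilityMeasure P] {K p : ℕ}
  {ν : Measure (Fin p → ℝ)} {ζ : ℝ} {Z : ∀ n : ℕ, Ω → Fin n → Fin n → Fin p → ℝ}

/-- The logarithms of the block sums concentrate, uniformly over assignments with large blocks. -/
lemma whp_abs_log_blockExp_sub_le [IsProbabilityMeasure ν] (hν : ∀ᵐ z ∂ν, ‖z‖ ≤ ζ)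
    (hm : ∀ n, Measurable (Z n)) (hZ : ∀ n, BoundedIID P ν ζ (Z n))
    (hsymm : ∀ n ω i j, Z n ω i j = Z n ω j i) (γ : Fin p → ℝ) {α η : ℝ} (hα : 0 < α)
    (hη : 0 < η) :
    Whp P fun n ω => ∀ (e : Fin n → Fin K) (k l : Fin K),
      α * (n : ℝ) ^ 2 ≤ blockCount e k l →
      |Real.log (blockExp (Z n ω) e γ k l)
        - (Real.log (blockCount e k l) + Real.log (theta ν γ))| ≤ η := by
  have hθ := theta_pos hν γ
  -- `s` is the relative error allowed for a block sum: the logarithm then errs by at most `2 s ≤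
  -- η`.
  set s := min (1 / 2) (η / 2) with hs
  have hs0 : 0 < s := lt_min (by norm_num) (by positivity)
  have hkl := Whp.forall_finset (P := P) (Finset.univ : Finset (Fin K × Fin K)) fun x _ =>
    whp_forall_abs_sum_lt hm hZ (blockWeight x.1 x.2) (measurable_exp_dotProduct γ)
      (fun z hz => abs_exp_dotProduct_le hz γ) (δ := s * α * theta ν γ) (by positivity)
  refine hkl.mono ?_
  filter_upwards [eventually_gt_atTop 0] with n hn ω hω e k l hcount
  have h1 := hω (k, l) (Finset.mem_univ _) e
  have hn' : (0 : ℝ) < n := by exact_mod_cast hn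
  have hc0 : 0 < blockCount e k l := lt_of_lt_of_le (by positivity) hcount
  have h2 : ∑ q : Pair n, blockWeight k l (e q.1.1) (e q.1.2) *
      (Real.exp (Z n ω q.1.1 q.1.2 ⬝ᵥ γ) - ∫ z, Real.exp (z ⬝ᵥ γ) ∂ν)
      = blockExp (Z n ω) e γ k l - blockCount e k l * theta ν γ := by
    rw [blockExp_eq_sum_pair (hsymm n ω), blockCount, Finset.sum_mul, ← Finset.sum_sub_distrib]
    exact Finset.sum_congr rfl fun q _ => mul_sub _ _ _
  simp only [h2] at h1
  have h3 := abs_log_sub_log_le (x := blockExp (Z n ω) e γ k l)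
    (y := blockCount e k l * theta ν γ) (s := s) (by positivity) (min_le_left _ _) (by
      refine h1.le.trans ?_
      calc s * α * theta ν γ * (n : ℝ) ^ 2 = s * (α * (n : ℝ) ^ 2 * theta ν γ) := by ring
        _ ≤ _ := by gcongr)
  rw [Real.log_mul hc0.ne' hθ.ne'] at h3
  have h4 : s ≤ η / 2 := min_le_right _ _
  linarith

variable {π : Fin K → ℝ} {B : Matrix (Fin K) (Fin K) ℝ} {ρ : ℕ → ℝ} {γ₀ : Fin p → ℝ}
  {c : ∀ n : ℕ, Ω → Fin n → Fin K} {A : ∀ n : ℕ, Ω → Fin n → Fin n → ℕ}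

/-- One positive entry `B a b` suffices: communities `a` and `b` both have linear size, so
quadratically many pairs join them. -/
lemma exists_whp_le_sum_connectivity (hπ : ∀ k, 0 < π k) (hsymm : B.IsSymm)
    (hB : ∀ a b, 0 ≤ B a b) (hB0 : B ≠ 0)
    (hmodel : ∀ n, IsPCABM P π (ρ n • B) γ₀ (c n) (Z n) (A n)) :
    ∃ β : ℝ, 0 < β ∧ Whp P fun n ω =>
      β * (n : ℝ) ^ 2 ≤ ∑ q : Pair n, B (c n ω q.1.1) (c n ω q.1.2) := by
  obtain ⟨a, b, hab⟩ : ∃ a b, 0 < B a b := by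
    by_contra! hcon
    exact hB0 (Matrix.ext fun a b => le_antisymm (hcon a b) (hB a b))
  have ha := hπ a
  have hb := hπ b
  -- `B a b` is halved because `blockWeight` equals `2` on pairs inside a block when `a = b`.
  refine ⟨B a b / 2 * (π a / 2 * (π b / 2) / 2), by positivity, ?_⟩
  refine ((whp_le_commSize hmodel a ha).and (whp_le_commSize hmodel b hb)).mono ?_
  filter_upwards [tendsto_natCast_atTop_atTop.eventually_ge_atTop
    (2 / (π a / 2 * (π b / 2)))] with n hn ω hω
  have h1 := blockCount_ge_of_commSize_ge (by positivity) (by positivity) hn hω.1 hω.2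
  calc B a b / 2 * (π a / 2 * (π b / 2) / 2) * (n : ℝ) ^ 2
      = B a b / 2 * (π a / 2 * (π b / 2) / 2 * (n : ℝ) ^ 2) := by ring
    _ ≤ B a b / 2 * blockCount (c n ω) a b := by gcongr
    _ ≤ _ := by
      rw [blockCount, Finset.mul_sum]
      refine Finset.sum_le_sum fun q _ => ?_
      unfold blockWeight
      have h0 := hB (c n ω q.1.1) (c n ω q.1.2)
      split_ifs with h2 h3 h3
      · rw [h2.1, h2.2]; linarith
      · rw [h2.1, h2.2]; linarith
      · rw [h3.1, h3.2, hsymm.apply]; linarith [hB b a]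
      · simpa using h0

lemma sum_mul_rate_eq {n : ℕ} (r : ℝ) (c : Fin n → Fin K) (Z : Fin n → Fin n → Fin p → ℝ)
    (g : (Fin p → ℝ) → ℝ) :
    ∑ q : Pair n, g (Z q.1.1 q.1.2) * rate (r • B) γ₀ c Z q.1.1 q.1.2
      = r * ∑ q : Pair n, B (c q.1.1) (c q.1.2) *
        (Real.exp (Z q.1.1 q.1.2 ⬝ᵥ γ₀) * g (Z q.1.1 q.1.2)) := by
  rw [Finset.mul_sum]
  refine Finset.sum_congr rfl fun q _ => ?_
  rw [rate_smul, rate]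
  ring

/-- The total weight of `A` is of order at most `N_n ρ_n`. -/
lemma exists_whp_sum_le (hB : ∀ a b, 0 ≤ B a b) (hρ : ∀ n, 0 < ρ n)
    (hmodel : ∀ n, IsPCABM P π (ρ n • B) γ₀ (c n) (Z n) (A n))
    (hZ : ∀ n, BoundedIID P ν ζ (Z n))
    (hNρ : Tendsto (fun n : ℕ => numPairs n * ρ n) atTop atTop) :
    ∃ C : ℝ, 0 < C ∧ Whp P fun n ω =>
      ∑ q : Pair n, (A n ω q.1.1 q.1.2 : ℝ) ≤ C * (numPairs n * ρ n) := by
  set b : ℝ := ∑ k, ∑ l, B k l with hb_def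
  have hb0 : 0 ≤ b := Finset.sum_nonneg fun _ _ => Finset.sum_nonneg fun _ _ => hB _ _
  have hb : ∀ k l, B k l ≤ b := fun k l =>
    (Finset.single_le_sum (f := fun l => B k l) (fun _ _ => hB _ _) (Finset.mem_univ l)).trans
      (Finset.single_le_sum (f := fun k => ∑ l, B k l)
        (fun _ _ => Finset.sum_nonneg fun _ _ => hB _ _) (Finset.mem_univ k))
  -- The `1` absorbs the Poisson deviation, taken with `δ = 1`.
  refine ⟨b * Real.exp (p * ζ * ‖γ₀‖) + 1, by positivity, ?_⟩
  have h1 := whp_abs_sum_sub_rate_lt hB hρ hmodel hZ hNρ (g := fun _ => 1) measurable_const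
    (C := 1) (fun _ _ => by simp) one_pos
  have h2 : Whp P fun n ω => ∀ q : Pair n, ‖Z n ω q.1.1 q.1.2‖ ≤ ζ :=
    Whp.of_ae (Eventually.of_forall fun n => (hZ n).ae_norm_le)
  refine (h1.and h2).mono (Eventually.of_forall fun n ω hω => ?_)
  have h3 := (abs_lt.1 hω.1).2
  simp only [one_mul, Finset.sum_sub_distrib] at h3
  have h4 : ∑ q : Pair n, rate (ρ n • B) γ₀ (c n ω) (Z n ω) q.1.1 q.1.2
      ≤ numPairs n * (ρ n * (b * Real.exp (p * ζ * ‖γ₀‖))) := by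
    refine (Finset.sum_le_card_nsmul _ _ (ρ n * (b * Real.exp (p * ζ * ‖γ₀‖))) ?_).trans ?_
    · intro q _
      rw [rate_smul]
      refine mul_le_mul_of_nonneg_left ?_ (hρ n).le
      exact mul_le_mul (hb _ _) (Real.exp_le_exp.2
        ((le_abs_self _).trans (abs_dotProduct_le (hω.2 q) γ₀))) (Real.exp_nonneg _) hb0
    · rw [nsmul_eq_mul, Finset.card_univ, card_pair]
  linarith

/-- The log-likelihood ratio with the normalizations replaced by their limits is of order
`-N_n ρ_n`. -/
lemma exists_whp_sum_mul_tilt_le [IsProbabilityMeasure ν] (hν : ∀ᵐ z ∂ν, ‖z‖ ≤ ζ)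
    (hπ : ∀ k, 0 < π k) (hsymm : B.IsSymm) (hB : ∀ a b, 0 ≤ B a b) (hB0 : B ≠ 0)
    (hρ : ∀ n, 0 < ρ n)
    (hmodel : ∀ n, IsPCABM P π (ρ n • B) γ₀ (c n) (Z n) (A n))
    (hZ : ∀ n, BoundedIID P ν ζ (Z n))
    (hNρ : Tendsto (fun n : ℕ => numPairs n * ρ n) atTop atTop)
    (hpd : (sigmaMat ν γ₀ -
      (theta ν γ₀)⁻¹ • vecMulVec (muVec ν γ₀) (muVec ν γ₀)).PosDef)
    {γ : Fin p → ℝ} (hne : γ ≠ γ₀) :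
    ∃ τ : ℝ, 0 < τ ∧ Whp P fun n ω => ∑ q : Pair n, (A n ω q.1.1 q.1.2 : ℝ) *
      tilt ν γ₀ γ (Z n ω q.1.1 q.1.2) ≤ -τ * (numPairs n * ρ n) := by
  obtain ⟨β, hβ, hβw⟩ := exists_whp_le_sum_connectivity hπ hsymm hB hB0 hmodel
  set m := ∫ z, Real.exp (z ⬝ᵥ γ₀) * tilt ν γ₀ γ z ∂ν with hm_def
  have hneg : m < 0 := integral_exp_mul_tilt_neg hν hne hpd
  set τ := -m * β with hτ_def
  have hτ : 0 < τ := mul_pos (neg_pos.2 hneg) hβ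
  refine ⟨τ / 2, by positivity, ?_⟩
  have h1 := whp_abs_sum_sub_rate_lt hB hρ hmodel hZ hNρ (measurable_tilt (ν := ν) γ₀ γ)
    (fun z hz => abs_tilt_le γ₀ γ hz) (δ := τ / 2) (by positivity)
  have h2 := whp_forall_abs_sum_lt (fun n => (hmodel n).measurable_Z) hZ (fun k l => B k l)
    ((measurable_exp_dotProduct γ₀).mul (measurable_tilt (ν := ν) γ₀ γ))
    (C := Real.exp (p * ζ * ‖γ₀‖) *
      (p * ζ * ‖γ - γ₀‖ + |Real.log (theta ν γ) - Real.log (theta ν γ₀)|))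
    (fun z hz => by
      rw [Pi.mul_apply, abs_mul]
      exact mul_le_mul (abs_exp_dotProduct_le hz γ₀) (abs_tilt_le γ₀ γ hz) (abs_nonneg _)
        (Real.exp_nonneg _)) (δ := τ / 2) (by positivity)
  refine ((h1.and h2).and hβw).mono (Eventually.of_forall fun n ω hω => ?_)
  obtain ⟨⟨hω1, hω2⟩, hω3⟩ := hω
  have h3 := (abs_lt.1 hω1).2
  -- Uniformity over assignments allows the true labels here, whatever their dependence on `Z`.
  have h4 := (abs_lt.1 (hω2 (c n ω))).2
  simp only [mul_sub, Finset.sum_sub_distrib] at h3 h4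
  rw [sum_mul_rate_eq] at h3
  simp only [Pi.mul_apply, ← Finset.sum_mul] at h4
  rw [← hm_def] at h4
  have h5 : (∑ q : Pair n, B (c n ω q.1.1) (c n ω q.1.2)) * m ≤ -τ * (n : ℝ) ^ 2 := by
    rw [hτ_def]
    nlinarith
  -- `-τ n²` plus the error `τ n² / 2` is at most `-τ N`, since `2 N ≤ n²`; the Poisson error then
  -- costs another `τ / 2`.
  have h6 : ∑ q : Pair n, B (c n ω q.1.1) (c n ω q.1.2) *
      (Real.exp (Z n ω q.1.1 q.1.2 ⬝ᵥ γ₀) * tilt ν γ₀ γ (Z n ω q.1.1 q.1.2))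
      ≤ -τ * numPairs n := by
    have := numPairs_le n
    nlinarith
  have h7 := mul_le_mul_of_nonneg_left h6 (hρ n).le
  have h8 : ∑ q : Pair n, (A n ω q.1.1 q.1.2 : ℝ) * tilt ν γ₀ γ (Z n ω q.1.1 q.1.2)
      = ∑ q : Pair n, tilt ν γ₀ γ (Z n ω q.1.1 q.1.2) * (A n ω q.1.1 q.1.2 : ℝ) :=
    Finset.sum_congr rfl fun q _ => mul_comm _ _
  rw [h8]
  linarith

/-- With high probability the profile log-likelihood near `γ ≠ γ₀` is below its value at `γ₀`. -/
lemma exists_whp_profileLogLik_lt [IsProbabilityMeasure ν] (hν : ∀ᵐ z ∂ν, ‖z‖ ≤ ζ) (hζ : 0 < ζ)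
    (hπ : ∀ k, 0 < π k) (hsymm : B.IsSymm) (hB : ∀ a b, 0 ≤ B a b) (hB0 : B ≠ 0)
    (hρ : ∀ n, 0 < ρ n)
    (hmodel : ∀ n, IsPCABM P π (ρ n • B) γ₀ (c n) (Z n) (A n))
    (hZ : ∀ n, BoundedIID P ν ζ (Z n))
    (hNρ : Tendsto (fun n : ℕ => numPairs n * ρ n) atTop atTop)
    (hpd : (sigmaMat ν γ₀ -
      (theta ν γ₀)⁻¹ • vecMulVec (muVec ν γ₀) (muVec ν γ₀)).PosDef)
    {e : ∀ n : ℕ, Ω → Fin n → Fin K} {κ : ℝ} (hκ : 0 < κ)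
    (he : ∀ᶠ n : ℕ in atTop, ∀ᵐ ω ∂P, ∀ k, κ * n ≤ (commSize (e n ω) k : ℝ))
    {γ : Fin p → ℝ} (hne : γ ≠ γ₀) :
    ∃ r : ℝ, 0 < r ∧ Whp P fun n ω => ∀ γ' : Fin p → ℝ, ‖γ' - γ‖ < r →
      profileLogLik (A n ω) (Z n ω) (e n ω) γ' < profileLogLik (A n ω) (Z n ω) (e n ω) γ₀ := by
  obtain ⟨τ, hτ, hτw⟩ := exists_whp_sum_mul_tilt_le hν hπ hsymm hB hB0 hρ hmodel hZ hNρ hpd hne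
  obtain ⟨C, hC, hCw⟩ := exists_whp_sum_le hB hρ hmodel hZ hNρ
  -- Per edge, moving from `γ` to `γ'` costs `p ζ r` in the linear term and `p ζ r` in the
  -- logarithms, and the two concentration errors cost `2 r`. Times the total weight `C N ρ` this is
  -- `τ N ρ / 2`.
  set r : ℝ := τ / (2 * C * (2 * p * ζ + 2)) with hr_def
  have hr : 0 < r := by positivity
  refine ⟨r, hr, ?_⟩
  have hm := fun n => (hmodel n).measurable_Z
  have hs := fun n => (hmodel n).Z_symm
  have hL := whp_abs_log_blockExp_sub_le (K := K) hν hm hZ hs γ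
    (α := κ * κ / 2) (η := r) (by positivity) hr
  have hL₀ := whp_abs_log_blockExp_sub_le (K := K) hν hm hZ hs γ₀
    (α := κ * κ / 2) (η := r) (by positivity) hr
  have hz : Whp P fun n ω => ∀ q : Pair n, ‖Z n ω q.1.1 q.1.2‖ ≤ ζ :=
    Whp.of_ae (Eventually.of_forall fun n => (hZ n).ae_norm_le)
  refine (((hτw.and hCw).and (hL.and hL₀)).and (hz.and (Whp.of_ae he))).mono ?_
  filter_upwards [hNρ.eventually_gt_atTop 0, tendsto_natCast_atTop_atTop.eventually_ge_atTop
    (2 / (κ * κ))] with n hNn hn ω hω γ' hγ'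
  obtain ⟨⟨⟨hD, hW⟩, hL, hL₀⟩, hz, he⟩ := hω
  -- The term `log (blockCount e k l)` is common to `γ` and `γ₀` and cancels, so the bound no longer
  -- involves `e`.
  have hlog : ∀ k l, Real.log (theta ν γ) - Real.log (theta ν γ₀) - 2 * r - p * ζ * r
        ≤ Real.log (blockExp (Z n ω) (e n ω) γ' k l)
          - Real.log (blockExp (Z n ω) (e n ω) γ₀ k l) := by
    intro k l
    have hcount : κ * κ / 2 * (n : ℝ) ^ 2 ≤ blockCount (e n ω) k l :=
      blockCount_ge_of_commSize_ge hκ hκ hn (he k) (he l)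
    have h1 := (abs_le.1 (hL (e n ω) k l hcount)).1
    have h2 := (abs_le.1 (hL₀ (e n ω) k l hcount)).2
    have h3 := log_blockExp_sub_le (e := e n ω) (k := k) (l := l) hζ.le (hs n ω) hz γ γ'
    rw [norm_sub_rev] at h3
    have h4 : p * ζ * ‖γ' - γ‖ ≤ p * ζ * r := by gcongr
    linarith
  have hterm : ∀ q : Pair n,
      (Z n ω q.1.1 q.1.2 ⬝ᵥ γ'
        - (Real.log (blockExp (Z n ω) (e n ω) γ' (e n ω q.1.1) (e n ω q.1.2))
          + Real.log (blockExp (Z n ω) (e n ω) γ' (e n ω q.1.2) (e n ω q.1.1))) / 2)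
      - (Z n ω q.1.1 q.1.2 ⬝ᵥ γ₀
        - (Real.log (blockExp (Z n ω) (e n ω) γ₀ (e n ω q.1.1) (e n ω q.1.2))
          + Real.log (blockExp (Z n ω) (e n ω) γ₀ (e n ω q.1.2) (e n ω q.1.1))) / 2)
      ≤ tilt ν γ₀ γ (Z n ω q.1.1 q.1.2) + (2 * p * ζ + 2) * r := by
    intro q
    have h1 := hlog (e n ω q.1.1) (e n ω q.1.2)
    have h2 := hlog (e n ω q.1.2) (e n ω q.1.1)
    have h3 := (le_abs_self _).trans (abs_dotProduct_le (hz q) (γ' - γ))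
    have h4 : p * ζ * ‖γ' - γ‖ ≤ p * ζ * r := by gcongr
    rw [dotProduct_sub] at h3
    rw [tilt, dotProduct_sub]
    linarith
  have hdiff : profileLogLik (A n ω) (Z n ω) (e n ω) γ' - profileLogLik (A n ω) (Z n ω) (e n ω) γ₀
      ≤ ∑ q : Pair n, (A n ω q.1.1 q.1.2 : ℝ) * tilt ν γ₀ γ (Z n ω q.1.1 q.1.2)
        + (∑ q : Pair n, (A n ω q.1.1 q.1.2 : ℝ)) * ((2 * p * ζ + 2) * r) := by
    rw [profileLogLik_eq_sum_pair ((hmodel n).A_symm ω) ((hmodel n).A_diag ω),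
      profileLogLik_eq_sum_pair ((hmodel n).A_symm ω) ((hmodel n).A_diag ω),
      ← Finset.sum_sub_distrib, Finset.sum_mul, ← Finset.sum_add_distrib]
    refine Finset.sum_le_sum fun q _ => ?_
    rw [← mul_sub, ← mul_add]
    exact mul_le_mul_of_nonneg_left (hterm q) (Nat.cast_nonneg _)
  have hslack : (∑ q : Pair n, (A n ω q.1.1 q.1.2 : ℝ)) * ((2 * p * ζ + 2) * r)
      ≤ τ / 2 * (numPairs n * ρ n) := by
    calc _ ≤ C * (numPairs n * ρ n) * ((2 * p * ζ + 2) * r) := by gcongr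
      _ = _ := by rw [hr_def]; field_simp
  have : 0 < τ * (numPairs n * ρ n) := mul_pos hτ hNn
  linarith

end Consistency

end PCABM

/-! ### Existence and consistency of the estimator. -/

theorem mainTheorem1
    {Ω : Type*} [MeasurableSpace Ω] (P : Measure Ω) [IsProbabilityMeasure P]
    {K p : ℕ}
    -- parameters of the model, not depending on the number `n` of nodes, except `ρ n`
    (π : Fin K → ℝ) (hπ_pos : ∀ k, 0 < π k) (hπ_sum : ∑ k, π k = 1)
    (Bbar : Matrix (Fin K) (Fin K) ℝ) (hB_symm : Bbar.IsSymm)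
    (hB_nonneg : ∀ a b, 0 ≤ Bbar a b) (hB_ne : Bbar ≠ 0)
    (ρ : ℕ → ℝ) (hρ_pos : ∀ n, 0 < ρ n) (hρ_zero : Tendsto ρ atTop (𝓝 0))
    (γ₀ : Fin p → ℝ)
    -- the model on `n` nodes, for every `n`
    (c : ∀ n : ℕ, Ω → Fin n → Fin K)
    (Z : ∀ n : ℕ, Ω → Fin n → Fin n → Fin p → ℝ)
    (A : ∀ n : ℕ, Ω → Fin n → Fin n → ℕ)
    (hmodel : ∀ n, PCABM.IsPCABM P π (ρ n • Bbar) γ₀ (c n) (Z n) (A n))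
    -- bounded i.i.d. covariates
    (ν : Measure (Fin p → ℝ)) (ζ : ℝ) (hζ : 0 < ζ)
    (hZ : ∀ n, PCABM.BoundedIID P ν ζ (Z n))
    -- positive definiteness
    (hpd : (PCABM.sigmaMat ν γ₀ -
      (PCABM.theta ν γ₀)⁻¹ •
        Matrix.vecMulVec (PCABM.muVec ν γ₀) (PCABM.muVec ν γ₀)).PosDef)
    -- non-degenerate, possibly random, initial assignments
    (e : ∀ n : ℕ, Ω → Fin n → Fin K)
    (κ₁ κ₂ : ℝ) (hκ₁ : 0 < κ₁) (hκ₁₂ : κ₁ ≤ κ₂) (hκ₂ : κ₂ < 1)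
    (he : ∀ᶠ n : ℕ in atTop, ∀ᵐ ω ∂P, ∀ k,
      κ₁ ≤ (PCABM.commSize (e n ω) k : ℝ) / n ∧ (PCABM.commSize (e n ω) k : ℝ) / n ≤ κ₂)
    (hNρ : Tendsto (fun n : ℕ => PCABM.numPairs n * ρ n) atTop atTop)
    -- the estimate: a maximizer of the profile log-likelihood whenever there is one
    (γhat : ∀ n : ℕ, Ω → Fin p → ℝ)
    (hγhat : ∀ n ω, (∃ γ, PCABM.IsProfileMLE (A n ω) (Z n ω) (e n ω) γ) →
      PCABM.IsProfileMLE (A n ω) (Z n ω) (e n ω) (γhat n ω)) :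
    Tendsto (fun n => P {ω | ¬ ∃ γ, PCABM.IsProfileMLE (A n ω) (Z n ω) (e n ω) γ})
        atTop (𝓝 0) ∧
      TendstoInMeasure P γhat atTop (fun _ => γ₀) := by
  have hm := fun n => (hmodel n).measurable_Z
  -- Two nodes are the fewest that form a pair, whose covariate passes its normalization and bound
  -- on to `ν`.
  obtain ⟨hνp, hν⟩ := (hZ 2).isProbabilityMeasure (hm 2) ⟨(0, 1), by decide⟩
  have he' : ∀ᶠ n : ℕ in atTop, ∀ᵐ ω ∂P, ∀ k, κ₁ * n ≤ (PCABM.commSize (e n ω) k : ℝ) := by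
    filter_upwards [he, eventually_gt_atTop 0] with n hn hn0
    filter_upwards [hn] with ω hω k
    exact (le_div_iff₀ (by exact_mod_cast hn0)).1 (hω k).1
  have main : ∀ ε : ℝ, 0 < ε → PCABM.Whp P fun n ω =>
      (∃ γ, PCABM.IsProfileMLE (A n ω) (Z n ω) (e n ω) γ) ∧ ‖γhat n ω - γ₀‖ < ε := by
    intro ε hε
    have hloc : ∀ γ ∈ Metric.sphere γ₀ ε, ∃ r : ℝ, 0 < r ∧ PCABM.Whp P fun n ω =>
        ∀ γ' : Fin p → ℝ, ‖γ' - γ‖ < r →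
          PCABM.profileLogLik (A n ω) (Z n ω) (e n ω) γ'
            < PCABM.profileLogLik (A n ω) (Z n ω) (e n ω) γ₀ := fun γ hγ =>
      PCABM.exists_whp_profileLogLik_lt hν hζ hπ_pos hB_symm hB_nonneg hB_ne hρ_pos hmodel hZ
        hNρ hpd hκ₁ he' (Metric.ne_of_mem_sphere hγ hε.ne')
    choose! r hr hrw using hloc
    -- Finitely many balls suffice, so the high-probability events can be intersected. Adjoining the
    -- complement of the sphere is harmless, as only points of the sphere are tested.
    obtain ⟨t, ht, hcover⟩ := (isCompact_sphere γ₀ ε).elim_nhds_subcover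
      (fun γ => Metric.ball γ (r γ) ∪ (Metric.sphere γ₀ ε)ᶜ) fun γ hγ =>
        mem_of_superset (Metric.ball_mem_nhds γ (hr γ hγ)) Set.subset_union_left
    refine (PCABM.Whp.forall_finset t fun γ hγ => hrw γ (ht γ hγ)).mono
      (Eventually.of_forall fun n ω hω => ?_)
    have hsphere : ∀ γ, ‖γ - γ₀‖ = ε → PCABM.profileLogLik (A n ω) (Z n ω) (e n ω) γ
        < PCABM.profileLogLik (A n ω) (Z n ω) (e n ω) γ₀ := by
      intro γ hγ
      have hmem : γ ∈ Metric.sphere γ₀ ε := by rwa [mem_sphere_iff_norm]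
      obtain ⟨γ₁, hγ₁, hball⟩ := Set.mem_iUnion₂.1 (hcover hmem)
      rcases hball with hball | hball
      · exact hω γ₁ hγ₁ γ (by rwa [Metric.mem_ball, dist_eq_norm] at hball)
      · exact absurd hmem hball
    obtain ⟨hex, hmax⟩ := PCABM.exists_forall_le_of_lt_on_sphere
      (PCABM.concaveOn_profileLogLik (A := A n ω) (Z := Z n ω) (e := e n ω)) hε hsphere
    exact ⟨hex, hmax _ (hγhat n ω hex)⟩
  refine ⟨(main 1 one_pos).mono (Eventually.of_forall fun n ω h => h.1), ?_⟩
  rw [tendstoInMeasure_iff_norm]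
  intro ε hε
  have h := (main ε hε).mono (Eventually.of_forall fun n ω h => h.2)
  simpa only [PCABM.Whp, not_lt] using h
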